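/- Let $k\ge 2$, $d\ge 2$. Let $\mathcal F_d$ be the set of pairs $f=(f_\infty,R)$, where $R$ is a homogeneous polynomial of degree $d$ on $\mathbb C^k$ and $f_\infty=(F_0,\dots,F_{k-1})$ is a $k$-tuple of homogeneous polynomials of degree $d$ on $\mathbb C^k$ whose only common zero is $0$; the induced endomorphism of $\mathbb P^{k-1}$ is also denoted by $f_\infty$. For $\varepsilon\in\mathbb C$ let $f_\varepsilon$ be the endomorphism $[z':z_k]\mapsto[f_\infty(z'):z_k^d+\varepsilon R(z')]$ of $\mathbb P^k$, where $z'=(z_0,\dots,z_{k-1})$, and let $f_\infty^+:\mathbb P^{k-1}\to\mathbb P^k$, $f_\infty^+(z)=[f_\infty(z):R(z)]$. Define * $X_{-1}=\{z\in\mathbb P^{k-1} : \sharp (f_\infty^+)^{-1}(f_\infty^+(z))\ge d^{k-2}+1\}$, where the points of $(f_\infty^+)^{-1}(f_\infty^+(z))\subset f_\infty^{-1}(f_\infty(z))$ are counted with their multiplicities as preimages under $f_\infty$, and $X=f_\infty(X_{-1})$; * $Y_{-2}=\{z\in\mathbb P^{k-1}: R(z)=0\}\cup\{z\in\mathbb P^{k-1}:\exists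 w\in\mathbb P^{k-1},\ f_\infty^+(z)\ne f_\infty^+(w),\ f_\infty(z)=f_\infty(w),\ f_1(f_\infty^+(z))=f_1(f_\infty^+(w))\}$ (replacing $f_1$ by any other $f_\varepsilon$ gives the same set), and $Y=f_\infty^2(Y_{-2})$. For $c>0$ put $U_\varepsilon=\{[z_0:\dots:z_k]\in\mathbb P^k : |z_k|\le c|\varepsilon|\max(|z_0|,\dots,|z_{k-1}|)\}$ and $\mathcal A_\varepsilon=\bigcap_{n\ge0}f_\varepsilon^n(U_\varepsilon)$. A trapping region for a set $\mathcal A$ under a map $g$ is a set $U$ with $g(U)\Subset \mathrm{int}\,U$ and $\mathcal A=\bigcap_{n\ge 0}g^n(U)$; an attracting set is a compact set having an open trapping region containing it. An endomorphism $g$ of $\mathbb P^k$ of degree $d$ is of small topological degree on an attracting set $\mathcal A$ of codimension $1$ if $\mathcal A$ has an open trapping region $U$ such that $$\limsup_{n\to\infty}\bigl(\sharp (g^{-n}(x)\cap U)\bigr)^{1/n}<d^{k-1}\qquad\text{for every }x\in\mathbb P^k,$$ points being counted with multiplicity. Suppose that $f\in\mathcal F_d$ satisfies 1. $X\cap Y=\varnothing$,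 and 2. there is $n\in\mathbb N$ with $\bigcap_{i=0}^n f_\infty^{-i}(X\cup Y)=\varnothing$. Then there is $c_0>0$, depending on $f$, such that for every $c\ge c_0$ there is $\varepsilon_0>0$ such that for all $\varepsilon\in\mathbb C$ with $0<|\varepsilon|<\varepsilon_0$: $U_\varepsilon$ is a trapping region for $\mathcal A_\varepsilon$ under $f_\varepsilon$; there are a point $I\notin U_\varepsilon$ and a hyperplane $L\subset U_\varepsilon$ such that for every $x\in L$ the intersection of $U_\varepsilon$ with the line $I(x)$ through $I$ and $x$ is star-shaped at $x$ in $I(x)\setminus I\simeq\mathbb C$; and $f_\varepsilon$ is of small topological degree on the attracting set $\mathcal A_\varepsilon$. -/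

import Mathlib

open scoped LinearAlgebra.Projectivization Topology ENNReal

noncomputable section

/-! ### Complex projective space -/

/-- Complex projective space of dimension `m - 1`, with homogeneous coordinates indexed by
`Fin m`. -/
abbrev CP (m : ℕ) : Type := ℙ ℂ (Fin m → ℂ)

/-- The usual topology of complex projective space: the quotient topology from `ℂ ^ m \ {0}`. -/
instance CP.instTopologicalSpace (m : ℕ) : TopologicalSpace (CP m) :=
  TopologicalSpace.coinduced
    (fun v : {v : Fin m → ℂ // v ≠ 0} => Projectivization.mk ℂ v.1 v.2) inferInstance

theorem eval_smul_of_isHomogeneous {n d : ℕ} {P : MvPolynomial (Fin n) ℂ}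
    (hP : P.IsHomogeneous d) (a : ℂ) (z : Fin n → ℂ) :
    MvPolynomial.eval (a • z) P = a ^ d * MvPolynomial.eval z P := by
  rw [MvPolynomial.eval_eq, MvPolynomial.eval_eq, Finset.mul_sum]
  refine Finset.sum_congr rfl fun e he => ?_
  have hdeg : ∑ i ∈ e.support, e i = d := by
    have := hP (MvPolynomial.mem_support_iff.1 he)
    simpa [Finsupp.weight_apply, Finsupp.sum] using this
  simp only [Pi.smul_apply, smul_eq_mul, mul_pow, Finset.prod_mul_distrib,
    Finset.prod_pow_eq_pow_sum, hdeg]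
  ring

/-- The map of projective spaces `[z] ↦ [P 0 (z) : ⋯ : P (m - 1) (z)]` given by homogeneous
polynomials of the same degree `d` without common zero outside the origin. -/
def projMap {n m d : ℕ} (P : Fin m → MvPolynomial (Fin n) ℂ) (hP : ∀ i, (P i).IsHomogeneous d)
    (h0 : ∀ z : Fin n → ℂ, (∀ i, MvPolynomial.eval z (P i) = 0) → z = 0) : CP n → CP m :=
  Projectivization.lift
    (fun z => Projectivization.mk ℂ (fun i => MvPolynomial.eval z.1 (P i))
      (fun h => z.2 (h0 z.1 fun i => congrFun h i)))
    (by
      rintro ⟨v, hv⟩ ⟨w, hw⟩ t (rfl : v = t • w)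
      rw [Projectivization.mk_eq_mk_iff']
      refine ⟨t ^ d, ?_⟩
      funext i
      simp [eval_smul_of_isHomogeneous (hP i)])

/-! ### Counting points of a fibre with multiplicity -/

/-- For a subset `S` of a fibre of `g`, the number of points of `S`, counted with multiplicity:
the largest number of points, arbitrarily near `S`, which a fibre of `g` has.

When `g` is a finite holomorphic map between complex manifolds of the same dimension, `g` takes, on
small disjoint neighbourhoods of the points `a ∈ S`, every generic value close to `g a` exactly
`mult_a(g)` times, and no value more often, so that this number is `∑ a ∈ S, mult_a(g)`. In
particular `countMult g {a}` is the local multiplicity (local degree) of `g` at `a`. -/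
def countMult {α β : Type*} [TopologicalSpace α] (g : α → β) (S : Set α) : ℕ∞ :=
  ⨅ W ∈ 𝓝ˢ S, ⨆ y : β, (g ⁻¹' {y} ∩ W).encard

/-- The count with multiplicity is at least the plain number of points. -/
theorem encard_le_countMult {α β : Type*} [TopologicalSpace α] (g : α → β) (S : Set α) (x : β)
    (hS : S ⊆ g ⁻¹' {x}) : S.encard ≤ countMult g S := by
  refine le_iInf₂ fun W hW => le_trans ?_ (le_iSup (fun y => (g ⁻¹' {y} ∩ W).encard) x)
  exact Set.encard_le_encard (Set.subset_inter hS (subset_of_mem_nhdsSet hW))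

/-! ### Attracting sets -/

/-- `U` is a trapping region of `f` (that is, `f U` is relatively compact in the interior of `U`;
the ambient space will be compact), with associated attracting set `A = ⋂ n, f ^ n (U)`. -/
def IsTrappingRegion {α : Type*} [TopologicalSpace α] (f : α → α) (A U : Set α) : Prop :=
  closure (f '' U) ⊆ interior U ∧ A = ⋂ n : ℕ, f^[n] '' U

/-- `A` is an attracting set of `f`: a compact set with an open neighbourhood `U` which is a
trapping region such that `A = ⋂ n, f ^ n (U)`. -/
def IsAttractingSet {α : Type*} [TopologicalSpace α] (f : α → α) (A : Set α) : Prop :=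
  IsCompact A ∧ ∃ U : Set α, IsOpen U ∧ A ⊆ U ∧ IsTrappingRegion f A U

/-- The map `f`, of algebraic degree `d`, is of small topological degree on its attracting set `A`
of dimension `s`: for some trapping region `U` of `A`,
`limsup (♯ (f ^ (-n) (x) ∩ U)) ^ (1 / n) < d ^ s` for all `x`. Points of `f ^ (-n) (x)` are counted
with multiplicity (which gives the stronger of the two possible notions). -/
def IsOfSmallTopologicalDegree {α : Type*} [TopologicalSpace α] (f : α → α) (d s : ℕ)
    (A : Set α) : Prop :=
  IsAttractingSet f A ∧ ∃ U : Set α, IsOpen U ∧ IsTrappingRegion f A U ∧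
    ∀ x : α, Filter.limsup
      (fun n : ℕ => ((countMult f^[n] (f^[n] ⁻¹' {x} ∩ U) : ℕ∞) : ℝ≥0∞) ^ (1 / (n : ℝ)))
      Filter.atTop < (d : ℝ≥0∞) ^ s

/-- The geometric condition (HD) in codimension `p` on a subset `U` of `ℙ ^ k`: there are projective
subspaces `I` and `L`, of dimensions `p - 1` and `k - p`, with `I ∩ U = ∅` and `L ⊆ U`, such that
for each `[x] ∈ L` the set `U ∩ I(x)`, where `I(x)` is the span of `I` and `[x]`, is star-shaped
at `[x]` in `I(x) \ I = {[x + v] | v ∈ I} ≅ ℂ ^ p`. -/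
def SatisfiesHD {k : ℕ} (p : ℕ) (U : Set (CP (k + 1))) : Prop :=
  1 ≤ p ∧ p ≤ k ∧ ∃ I L : Submodule ℂ (Fin (k + 1) → ℂ),
    Module.finrank ℂ I = p ∧ Module.finrank ℂ L = k - p + 1 ∧
    (∀ v (hv : v ≠ 0), v ∈ I → Projectivization.mk ℂ v hv ∉ U) ∧
    (∀ x (hx : x ≠ 0), x ∈ L → Projectivization.mk ℂ x hx ∈ U) ∧
    ∀ x ∈ L, x ≠ 0 → ∀ v ∈ I, ∀ t : ℝ, 0 ≤ t → t ≤ 1 →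
      ∀ (h : x + v ≠ 0) (h' : x + (t : ℂ) • v ≠ 0),
        Projectivization.mk ℂ (x + v) h ∈ U → Projectivization.mk ℂ (x + (t : ℂ) • v) h' ∈ U

/-! ### The family of maps -/

/-- The set `𝓕_d` (for `d ≥ 2`) of pairs `(f_∞, R)`: `R` is a homogeneous polynomial of degree `d`
on `ℂ ^ k`, and `f_∞ = (F 0, …, F (k - 1))` is a `k`-tuple of homogeneous polynomials of degree `d`
which defines a holomorphic endomorphism of `ℙ ^ (k - 1)`, i.e. without common zero except `0`. -/
structure PencilPair (k d : ℕ) where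
  F : Fin k → MvPolynomial (Fin k) ℂ
  R : MvPolynomial (Fin k) ℂ
  two_le_degree : 2 ≤ d
  isHomogeneous_F : ∀ i, (F i).IsHomogeneous d
  isHomogeneous_R : R.IsHomogeneous d
  eq_zero_of_eval_F : ∀ z : Fin k → ℂ, (∀ i, MvPolynomial.eval z (F i) = 0) → z = 0

namespace PencilPair

variable {k d : ℕ} (f : PencilPair k d)

/-- The endomorphism `f_∞` of `ℙ ^ (k - 1)`. -/
def fInf : CP k → CP k :=
  projMap f.F f.isHomogeneous_F f.eq_zero_of_eval_F

/-- The map `f_∞⁺ : [z] ↦ [f_∞(z) : R(z)]` from `ℙ ^ (k - 1)` to `ℙ ^ k`. -/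
def fPlus : CP k → CP (k + 1) :=
  projMap (d := d) (Fin.snoc (α := fun _ => MvPolynomial (Fin k) ℂ) f.F f.R)
    (Fin.lastCases (by simpa using f.isHomogeneous_R) (fun i => by
      simpa using f.isHomogeneous_F i))
    (fun z hz => f.eq_zero_of_eval_F z fun i => by simpa using hz i.castSucc)

/-- The endomorphism `f_ε : [z' : z_k] ↦ [f_∞(z') : z_k ^ d + ε R(z')]` of `ℙ ^ k`. -/
def fEps (ε : ℂ) : CP (k + 1) → CP (k + 1) :=
  projMap (d := d)
    (Fin.snoc (α := fun _ => MvPolynomial (Fin (k + 1)) ℂ)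
      (fun i => MvPolynomial.rename Fin.castSucc (f.F i))
      (MvPolynomial.X (Fin.last k) ^ d
        + MvPolynomial.C ε * MvPolynomial.rename Fin.castSucc f.R))
    (Fin.lastCases
      (by
        have h1 : (MvPolynomial.X (Fin.last k) ^ d : MvPolynomial (Fin (k + 1)) ℂ).IsHomogeneous
            d := MvPolynomial.isHomogeneous_X_pow _ _
        have h2 := (MvPolynomial.isHomogeneous_C (Fin (k + 1)) ε).mul
          (f.isHomogeneous_R.rename_isHomogeneous (f := Fin.castSucc))
        rw [zero_add] at h2
        simpa using h1.add h2)
      (fun i => by simpa using (f.isHomogeneous_F i).rename_isHomogeneous))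
    (fun z hz => by
      have hd : d ≠ 0 := by have := f.two_le_degree; omega
      have hz' : z ∘ Fin.castSucc = 0 := f.eq_zero_of_eval_F _ fun i => by
        simpa [MvPolynomial.eval_rename] using hz i.castSucc
      have hR : MvPolynomial.eval (0 : Fin k → ℂ) f.R = 0 := by
        have := eval_smul_of_isHomogeneous f.isHomogeneous_R 0 0
        simpa [hd] using this
      have hl := hz (Fin.last k)
      simp only [Fin.snoc_last, map_add, map_mul, map_pow, MvPolynomial.eval_X,
        MvPolynomial.eval_C, MvPolynomial.eval_rename, hz', hR, mul_zero, add_zero] at hl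
      funext j
      exact Fin.lastCases (motive := fun j => z j = 0) (eq_zero_of_pow_eq_zero hl)
        (fun i => congrFun hz' i) j)

/-- The set `X_{-1}` of the `z` such that the fibre of `f_∞⁺` through `z`, which is part of a fibre
of `f_∞`, has at least `d ^ (k - 2) + 1` points, counted with their multiplicities as preimages
under `f_∞`. -/
def XMinusOne : Set (CP k) :=
  {z | ((d ^ (k - 2) + 1 : ℕ) : ℕ∞) ≤ countMult f.fInf (f.fPlus ⁻¹' {f.fPlus z})}

/-- The set `X = f_∞(X_{-1})`. -/
def X : Set (CP k) := f.fInf '' f.XMinusOne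

/-- The set `Y_{-2}`. The pair `f` acts on `ℙ ^ k` as `f_1`; any other `f_ε` gives the same set, see
`fEps_fPlus_eq_iff`. -/
def YMinusTwo : Set (CP k) :=
  {z | MvPolynomial.eval z.rep f.R = 0} ∪
  {z | ∃ w, f.fPlus z ≠ f.fPlus w ∧ f.fInf z = f.fInf w ∧
    f.fEps 1 (f.fPlus z) = f.fEps 1 (f.fPlus w)}

/-- The set `Y = f_∞ ^ 2 (Y_{-2})`. -/
def Y : Set (CP k) := f.fInf^[2] '' f.YMinusTwo

/-- The set `Z = X ∪ Y`. -/
def Z : Set (CP k) := f.X ∪ f.Y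

/-- The set `U_ε` of the `[z_0 : ⋯ : z_k]` with `|z_k| ≤ c |ε| max (|z_0|, …, |z_{k-1}|)`. (The norm
of `Fin k → ℂ` is the maximum norm.) -/
def U (_f : PencilPair k d) (c : ℝ) (ε : ℂ) : Set (CP (k + 1)) :=
  {z | ‖z.rep (Fin.last k)‖ ≤ c * ‖ε‖ * ‖fun i : Fin k => z.rep i.castSucc‖}

/-- The set `𝒜_ε = ⋂ n, f_ε ^ n (U_ε)`. -/
def A (c : ℝ) (ε : ℂ) : Set (CP (k + 1)) :=
  ⋂ n : ℕ, (f.fEps ε)^[n] '' f.U c ε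

theorem fInf_mk (v : Fin k → ℂ) (hv : v ≠ 0) :
    ∃ h, f.fInf (Projectivization.mk ℂ v hv)
      = Projectivization.mk ℂ (fun i => MvPolynomial.eval v (f.F i)) h :=
  ⟨_, rfl⟩

theorem fEps_fPlus_mk (ε : ℂ) (v : Fin k → ℂ) (hv : v ≠ 0) :
    ∃ h, f.fEps ε (f.fPlus (Projectivization.mk ℂ v hv)) =
      Projectivization.mk ℂ (Fin.snoc (α := fun _ => ℂ)
        (fun i => MvPolynomial.eval (fun j => MvPolynomial.eval v (f.F j)) (f.F i))
        (MvPolynomial.eval v f.R ^ d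
          + ε * MvPolynomial.eval (fun j => MvPolynomial.eval v (f.F j)) f.R)) h := by
  have key : ∀ (a b : Fin (k + 1) → ℂ) (ha : a ≠ 0), a = b →
      ∃ h, Projectivization.mk ℂ a ha = Projectivization.mk ℂ b h := by
    rintro a _ ha rfl; exact ⟨ha, rfl⟩
  refine key _ _ _ ?_
  funext j
  refine Fin.lastCases ?_ (fun i => ?_) j <;>
    simp [MvPolynomial.eval_rename, Function.comp_def]

/-- On pairs of points in one fibre of `f_∞`, the relation `f_ε(f_∞⁺(z)) = f_ε(f_∞⁺(w))` does not
depend on `ε`. -/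
theorem fEps_fPlus_eq_iff (ε : ℂ) (z w : CP k) (h : f.fInf z = f.fInf w) :
    f.fEps ε (f.fPlus z) = f.fEps ε (f.fPlus w) ↔
      f.fEps 1 (f.fPlus z) = f.fEps 1 (f.fPlus w) := by
  induction z using Projectivization.ind with | h u hu => ?_
  induction w using Projectivization.ind with | h v hv => ?_
  obtain ⟨h1, e1⟩ := f.fInf_mk u hu
  obtain ⟨h2, e2⟩ := f.fInf_mk v hv
  rw [e1, e2, Projectivization.mk_eq_mk_iff'] at h
  obtain ⟨t, ht⟩ := h
  have main : ∀ η : ℂ, f.fEps η (f.fPlus (Projectivization.mk ℂ u hu))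
      = f.fEps η (f.fPlus (Projectivization.mk ℂ v hv)) ↔
      MvPolynomial.eval u f.R ^ d = t ^ d * MvPolynomial.eval v f.R ^ d := by
    intro η
    obtain ⟨g1, E1⟩ := f.fEps_fPlus_mk η u hu
    obtain ⟨g2, E2⟩ := f.fEps_fPlus_mk η v hv
    rw [E1, E2, Projectivization.mk_eq_mk_iff']
    have hRR := eval_smul_of_isHomogeneous f.isHomogeneous_R t
      (fun j => MvPolynomial.eval v (f.F j))
    have hFF := fun i => eval_smul_of_isHomogeneous (f.isHomogeneous_F i) t
      (fun j => MvPolynomial.eval v (f.F j))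
    rw [ht] at hRR
    simp only [ht] at hFF
    constructor
    · rintro ⟨a, ha⟩
      have hi : ∃ i, MvPolynomial.eval (fun j => MvPolynomial.eval v (f.F j)) (f.F i) ≠ 0 := by
        by_contra! hcon
        exact h2 (f.eq_zero_of_eval_F _ hcon)
      obtain ⟨i, hi⟩ := hi
      have hai := congrFun ha i.castSucc
      have hal := congrFun ha (Fin.last k)
      simp only [Pi.smul_apply, Fin.snoc_castSucc, Fin.snoc_last, smul_eq_mul, hFF, hRR]
        at hai hal
      have hat := mul_right_cancel₀ hi hai
      subst hat
      linear_combination -hal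
    · intro hR
      refine ⟨t ^ d, ?_⟩
      funext j
      refine Fin.lastCases ?_ (fun i => ?_) j
      · simp only [Pi.smul_apply, Fin.snoc_last, smul_eq_mul, hRR, hR]
        ring
      · simp only [Pi.smul_apply, Fin.snoc_castSucc, smul_eq_mul, hFF]
  rw [main, main]

end PencilPair

end

noncomputable section

/-! ### Homogeneous systems of parameters of polynomial rings -/

namespace MvPolynomial

variable {k d : ℕ}

/-! Write points of the tube as `[z : ε u]`. In these coordinates `f_ε` is the map `(z, u) ↦ (F z, R
z + ε ^ (d - 1) u ^ d)`, so for small `ε` it is a small perturbation of `(z, u) ↦ f_∞⁺ z`, and the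
projection `π` to `z` semiconjugates it to `f_∞`. Homogeneity bounds `|R|` by a multiple of `‖F‖`.
This makes the tube trapping once `c` is large and `ε` is small.

For the degree, consider the preimages `y` of a point `x` of the tube. Bézout allows at most `d ^ (k
- 1)` base points `π y`, and over each of them `u ^ d` is determined, which leaves at most `d`
values of `u`. Two independent savings of a factor `d` are available. Away from `X`: the base points
have nearly the same image under `f_∞⁺`, so there are at most `d ^ (k - 2)` of them
(`encard_image_base_le`). Away from `Y`: if `y` itself lies in the image of the tube, then `u` is
close to a value of `R`, and the power map separates such values, so there is one `y` over each base
point (`injOn_base`).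

Since `X` and `Y` are disjoint, they have disjoint neighbourhoods, and at least one saving always
applies, giving at most `d ^ (k - 1)` preimages in the image of the tube. Off both neighbourhoods
both savings apply and the bound is `d ^ (k - 2)`. Condition 2 and compactness force every
`f_∞`-orbit out of the two neighbourhoods within a bounded time, so a factor `d` is gained at
bounded intervals along each backward branch. The growth rate is therefore strictly below `d ^ (k -
1)` (`ncard_iterate_fiber_le`).

Multiplicities need no separate treatment: `countMult` is bounded by the largest plain cardinality
of a fibre in an open set, and the bounds are uniform over fibres. Only an upper bound of Bézout
type is used. It comes from the degree of minimal polynomials over `ℂ[F]`. -/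

theorem homogeneousComponent_mul_of_isHomogeneous {σ : Type*} {R : Type*} [CommSemiring R]
    {p : MvPolynomial σ R} {m : ℕ} (hp : p.IsHomogeneous m) (q : MvPolynomial σ R) (n : ℕ) :
    homogeneousComponent (m + n) (p * q) = p * homogeneousComponent n q := by
  conv_lhs => rw [← sum_homogeneousComponent q, Finset.mul_sum, map_sum]
  have h : ∀ i, homogeneousComponent (m + n) (p * homogeneousComponent i q) =
      if i = n then p * homogeneousComponent n q else 0 := by
    intro i
    rw [homogeneousComponent_of_mem (n := m + i)
      ((mem_homogeneousSubmodule _ _).2 (hp.mul (homogeneousComponent_isHomogeneous i q)))]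
    by_cases hi : i = n
    · simp [hi]
    · rw [if_neg (by omega), if_neg hi]
  simp only [h, Finset.sum_ite_eq', Finset.mem_range]
  split_ifs with hn
  · rfl
  · rw [homogeneousComponent_eq_zero _ _ (by omega), mul_zero]

theorem exists_X_pow_mem_span_of_forall_eq_zero (F : Fin k → MvPolynomial (Fin k) ℂ)
    (h0 : ∀ z : Fin k → ℂ, (∀ i, eval z (F i) = 0) → z = 0) :
    ∃ T : ℕ, ∀ i, (X i : MvPolynomial (Fin k) ℂ) ^ T ∈ Ideal.span (Set.range F) := by
  have h : ∀ i, (X i : MvPolynomial (Fin k) ℂ) ∈ (Ideal.span (Set.range F)).radical := by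
    intro i
    rw [← vanishingIdeal_zeroLocus_eq_radical (K := ℂ), mem_vanishingIdeal_iff]
    intro z hz
    rw [zeroLocus_span] at hz
    have : z = 0 := h0 z fun j => hz (F j) ⟨j, rfl⟩
    simp [this]
  choose T hT using h
  refine ⟨∑ i, T i, fun i => ?_⟩
  exact Ideal.pow_mem_of_pow_mem _ (hT i) (Finset.single_le_sum (f := T)
    (fun _ _ => Nat.zero_le _) (Finset.mem_univ i))

/-- A graded Nakayama argument. By the Nullstellensatz a power `T` of every variable lies in the
ideal of the `F j`. A monomial with a large exponent is thus a combination of the `F j` with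
coefficients of lower degree, and induction on the degree reduces to the finitely many monomials
with all exponents at most `T`. -/
theorem finite_adjoin_of_forall_eq_zero (hd : 1 ≤ d) (F : Fin k → MvPolynomial (Fin k) ℂ)
    (hF : ∀ i, (F i).IsHomogeneous d)
    (h0 : ∀ z : Fin k → ℂ, (∀ i, eval z (F i) = 0) → z = 0) :
    Module.Finite (Algebra.adjoin ℂ (Set.range F)) (MvPolynomial (Fin k) ℂ) := by
  obtain ⟨T₀, hT₀⟩ := exists_X_pow_mem_span_of_forall_eq_zero F h0
  obtain ⟨T, hdT, hT⟩ : ∃ T, d ≤ T ∧ ∀ i, (X i : MvPolynomial (Fin k) ℂ) ^ T ∈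
      Ideal.span (Set.range F) :=
    ⟨max d T₀, le_max_left _ _, fun i => Ideal.pow_mem_of_pow_mem _ (hT₀ i) (le_max_right _ _)⟩
  set B := Algebra.adjoin ℂ (Set.range F)
  set s : Set (MvPolynomial (Fin k) ℂ) :=
    (fun e : Fin k →₀ ℕ => monomial e (1 : ℂ)) '' {e | ∀ i, e i ≤ T}
  have hs : s.Finite := by
    refine Set.Finite.image _ ?_
    exact (Set.Finite.pi' fun _ => Set.finite_le_nat T).preimage DFunLike.coe_injective.injOn
  -- Taking homogeneous components makes the coefficients homogeneous of degree `T - d`, so that the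
  -- degree really drops by `d` in the induction.
  have hX : ∀ i, ∃ a : Fin k → MvPolynomial (Fin k) ℂ, (∀ j, (a j).IsHomogeneous (T - d)) ∧
      X i ^ T = ∑ j, F j * a j := by
    intro i
    obtain ⟨c, hc⟩ := Ideal.mem_span_range_iff_exists_fun.1 (hT i)
    refine ⟨fun j => homogeneousComponent (T - d) (c j),
      fun j => homogeneousComponent_isHomogeneous _ _, ?_⟩
    have h1 : homogeneousComponent (d + (T - d)) ((X i : MvPolynomial (Fin k) ℂ) ^ T) =
        X i ^ T := by
      rw [homogeneousComponent_of_mem (n := T)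
        ((mem_homogeneousSubmodule _ _).2 (isHomogeneous_X_pow i T)), if_pos (by omega)]
    rw [← h1, ← hc, map_sum]
    exact Finset.sum_congr rfl fun j _ => by
      rw [mul_comm, homogeneousComponent_mul_of_isHomogeneous (hF j)]
  have main : ∀ n : ℕ, ∀ p : MvPolynomial (Fin k) ℂ, p.IsHomogeneous n →
      p ∈ Submodule.span B s := by
    intro n
    induction n using Nat.strong_induction_on with
    | _ n ih =>
    intro p hp
    rw [p.as_sum]
    refine Submodule.sum_mem _ fun e he => ?_
    have hdeg : e.degree = n := by
      rw [Finsupp.degree_eq_weight_one]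
      exact hp (mem_support_iff.1 he)
    have hm : monomial e (coeff e p) =
        (algebraMap ℂ B (coeff e p)) • (monomial e 1 : MvPolynomial (Fin k) ℂ) := by
      rw [algebraMap_smul, smul_monomial, smul_eq_mul, mul_one]
    rw [hm]
    refine Submodule.smul_mem _ _ ?_
    by_cases hle : ∀ i, e i ≤ T
    · exact Submodule.subset_span ⟨e, hle, rfl⟩
    push Not at hle
    obtain ⟨i, hi⟩ := hle
    obtain ⟨a, ha, hXa⟩ := hX i
    have hsplit : e = Finsupp.single i T + (e - Finsupp.single i T) := by
      rw [add_tsub_cancel_of_le]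
      simpa using hi.le
    have he' : (monomial e (1 : ℂ)) =
        ∑ j, F j * (a j * monomial (e - Finsupp.single i T) 1) := by
      conv_lhs => rw [hsplit, ← one_mul (1 : ℂ), ← monomial_mul, ← X_pow_eq_monomial, hXa,
        Finset.sum_mul]
      exact Finset.sum_congr rfl fun j _ => mul_assoc _ _ _
    rw [he']
    refine Submodule.sum_mem _ fun j _ => ?_
    have hFB : F j ∈ B := Algebra.subset_adjoin ⟨j, rfl⟩
    have : F j * (a j * monomial (e - Finsupp.single i T) 1) =
        (⟨F j, hFB⟩ : B) • (a j * monomial (e - Finsupp.single i T) 1) := rfl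
    rw [this]
    refine Submodule.smul_mem _ _ (ih (n - d) ?_ _ ?_)
    · have : e i ≤ e.degree := Finsupp.le_degree i e
      omega
    · have h2 : (e - Finsupp.single i T).degree = n - T := by
        have := congrArg Finsupp.degree hsplit
        rw [map_add, Finsupp.degree_single, hdeg] at this
        omega
      have h3 := (ha j).mul (isHomogeneous_monomial (1 : ℂ) h2)
      have : e i ≤ e.degree := Finsupp.le_degree i e
      rwa [show T - d + (n - T) = n - d by omega] at h3
  refine ⟨⟨hs.toFinset, ?_⟩⟩
  rw [Set.Finite.coe_toFinset, eq_top_iff]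
  intro p _
  rw [← sum_homogeneousComponent p]
  exact Submodule.sum_mem _ fun i _ => main i _ (homogeneousComponent_isHomogeneous i p)

/-- The polynomial ring has transcendence degree `k` and is algebraic over the algebra generated by
the `k` elements `F i`, so these form a transcendence basis. -/
theorem algebraicIndependent_of_forall_eq_zero (hd : 1 ≤ d) (F : Fin k → MvPolynomial (Fin k) ℂ)
    (hF : ∀ i, (F i).IsHomogeneous d)
    (h0 : ∀ z : Fin k → ℂ, (∀ i, eval z (F i) = 0) → z = 0) : AlgebraicIndependent ℂ F := by
  have := finite_adjoin_of_forall_eq_zero hd F hF h0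
  have h1 : Algebra.IsIntegral (Algebra.adjoin ℂ (Set.range F)) (MvPolynomial (Fin k) ℂ) :=
    inferInstance
  have h2 : Algebra.IsAlgebraic (Algebra.adjoin ℂ (Set.range F)) (MvPolynomial (Fin k) ℂ) :=
    h1.isAlgebraic
  exact (Algebra.IsAlgebraic.isTranscendenceBasis_of_le_trdeg_of_finite ℂ F
    (by simp [trdeg_of_isDomain])).1

theorem totalDegree_aeval_le_of_isHomogeneous (F : Fin k → MvPolynomial (Fin k) ℂ)
    (hF : ∀ i, (F i).IsHomogeneous d) (p : MvPolynomial (Fin k) ℂ) :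
    (aeval F p).totalDegree ≤ d * p.totalDegree := by
  conv_lhs => rw [← sum_homogeneousComponent p, map_sum]
  refine totalDegree_finsetSum_le fun i hi => ?_
  refine ((homogeneousComponent_isHomogeneous i p).aeval F hF).totalDegree_le.trans ?_
  gcongr
  have := Finset.mem_range.1 hi
  omega

theorem finrank_restrictTotalDegree (hk : 1 ≤ k) (s : ℕ) :
    Module.finrank ℂ (restrictTotalDegree (Fin k) ℂ s) = (s + k).choose k := by
  rw [restrictTotalDegree, Module.finrank_eq_nat_card_basis (basisRestrictSupport ℂ _)]
  have h : {n : Fin k →₀ ℕ | (n.sum fun _ e => e) ≤ s} =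
      ((Finset.range (s + 1)).biUnion fun j => (Finset.univ : Finset (Fin k)).finsuppAntidiag j :
        Finset (Fin k →₀ ℕ)) := by
    ext e
    simp [Finsupp.sum_fintype]
  rw [h, Nat.card_coe_set_eq, Set.ncard_coe_finset, Finset.card_biUnion]
  · simp only [Finset.card_finsuppAntidiag_nat_eq_choose, Finset.card_univ, Fintype.card_fin]
    obtain ⟨m, rfl⟩ : ∃ m, k = m + 1 := ⟨k - 1, by omega⟩
    rw [← add_assoc, ← Nat.sum_range_add_choose s m]
    refine Finset.sum_congr rfl fun j _ => ?_
    rw [show m + 1 + j - 1 = j + m by omega, ← Nat.choose_symm_add]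
  · intro i _ j _ hij
    exact Finset.disjoint_left.2 fun e h1 h2 => hij (by
      rw [Finset.mem_finsuppAntidiag] at h1 h2
      exact h1.1.symm.trans h2.1)

/-- Both sides are polynomials of degree `k` in `s`; comparison of leading coefficients as `s → ∞`
gives the bound. -/
theorem le_pow_of_forall_mul_choose_le {n t : ℕ}
    (h : ∀ s, n * (s + k).choose k ≤ (d * s + t + k).choose k) : n ≤ d ^ k := by
  have h1 : ∀ s : ℕ, n * (s + 1) ^ k ≤ (d * s + t + k) ^ k := fun s =>
    calc n * (s + 1) ^ k ≤ n * (s + 1).ascFactorial k :=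
          Nat.mul_le_mul_left _ (Nat.pow_succ_le_ascFactorial _ _)
      _ = k.factorial * (n * (s + k).choose k) := by
          rw [Nat.ascFactorial_eq_factorial_mul_choose]; ring
      _ ≤ k.factorial * (d * s + t + k).choose k := Nat.mul_le_mul_left _ (h s)
      _ = (d * s + t + 1).ascFactorial k := (Nat.ascFactorial_eq_factorial_mul_choose _ _).symm
      _ ≤ _ := Nat.ascFactorial_le_pow_add _ _
  have h2 : ∀ s : ℕ, (n : ℝ) ≤ (d + ((t + k : ℕ) : ℝ) / (s + 1 : ℝ)) ^ k := by
    intro s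
    have hs : (0 : ℝ) < (s : ℝ) + 1 := by positivity
    have h3 : (n : ℝ) * ((s : ℝ) + 1) ^ k ≤ (d * s + t + k) ^ k := by exact_mod_cast h1 s
    have h4 : (d * s + t + k : ℝ) ^ k ≤ ((d + ((t + k : ℕ) : ℝ) / (s + 1 : ℝ)) * (s + 1)) ^ k := by
      gcongr
      rw [add_mul, div_mul_cancel₀ _ hs.ne']
      push_cast
      nlinarith [(Nat.cast_nonneg d : (0 : ℝ) ≤ d)]
    rw [mul_pow] at h4
    exact le_of_mul_le_mul_right (h3.trans h4) (by positivity)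
  have h5 : Filter.Tendsto (fun s : ℕ => ((d : ℝ) + ((t + k : ℕ) : ℝ) / (s + 1 : ℝ)) ^ k)
      Filter.atTop (𝓝 ((d + 0) ^ k)) := by
    refine Filter.Tendsto.pow (Filter.Tendsto.const_add _ ?_) _
    exact (tendsto_const_div_atTop_nhds_zero_nat ((t + k : ℕ) : ℝ)).comp
      (Filter.tendsto_add_atTop_nat 1) |>.congr fun s => by simp
  have h6 := ge_of_tendsto' h5 h2
  rw [add_zero] at h6
  exact_mod_cast h6

/-- If the minimal polynomial has degree `n`, the powers `1, h, …, h ^ (n - 1)` are independent over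
`ℂ[F]`. Multiplying them by polynomials in `F` of degree at most `s` embeds `n` copies of the
polynomials of degree at most `s` into those of degree at most `d s + t`, with `t` independent of
`s`. Counting dimensions bounds `n`. Algebraic independence makes `ℂ[F]` a polynomial ring, hence
integrally closed, so the minimal polynomial has least degree among all nonzero annihilating
polynomials, not only monic ones. -/
theorem natDegree_minpoly_le (hk : 1 ≤ k) (hd : 1 ≤ d) (F : Fin k → MvPolynomial (Fin k) ℂ)
    (hF : ∀ i, (F i).IsHomogeneous d)
    (h0 : ∀ z : Fin k → ℂ, (∀ i, eval z (F i) = 0) → z = 0) (h : MvPolynomial (Fin k) ℂ) :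
    (minpoly (Algebra.adjoin ℂ (Set.range F)) h).natDegree ≤ d ^ k := by
  have hind := algebraicIndependent_of_forall_eq_zero hd F hF h0
  set B := Algebra.adjoin ℂ (Set.range F)
  have hB : IsIntegrallyClosed B := IsIntegrallyClosed.of_equiv hind.aevalEquiv.toRingEquiv
  set n := (minpoly B h).natDegree with hn
  refine le_pow_of_forall_mul_choose_le (t := h.totalDegree * n) fun s => ?_
  let Φ₀ : (Fin n → restrictTotalDegree (Fin k) ℂ s) →ₗ[ℂ] MvPolynomial (Fin k) ℂ :=
    ∑ i : Fin n, LinearMap.mulRight ℂ (h ^ (i : ℕ)) ∘ₗ (aeval F).toLinearMap ∘ₗ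
      (restrictTotalDegree (Fin k) ℂ s).subtype ∘ₗ LinearMap.proj i
  have hΦ₀ : ∀ b, Φ₀ b = ∑ i : Fin n, aeval F (b i : MvPolynomial (Fin k) ℂ) * h ^ (i : ℕ) := by
    intro b
    simp [Φ₀]
  have hdeg : ∀ b, Φ₀ b ∈ restrictTotalDegree (Fin k) ℂ (d * s + h.totalDegree * n) := by
    intro b
    rw [mem_restrictTotalDegree, hΦ₀]
    refine totalDegree_finsetSum_le fun i _ => (totalDegree_mul _ _).trans ?_
    refine Nat.add_le_add ((totalDegree_aeval_le_of_isHomogeneous F hF _).trans ?_)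
      ((totalDegree_pow _ _).trans ?_)
    · exact Nat.mul_le_mul_left _ ((mem_restrictTotalDegree _ _ _).1 (b i).2)
    · rw [mul_comm]
      exact Nat.mul_le_mul_left _ i.2.le
  have hinj : Function.Injective (Φ₀.codRestrict _ hdeg) := by
    rw [← LinearMap.ker_eq_bot, LinearMap.ker_codRestrict, LinearMap.ker_eq_bot']
    intro b hb
    rw [hΦ₀] at hb
    have hmem : ∀ p, aeval F p ∈ B := fun p => by
      rw [show B = _ from Algebra.adjoin_range_eq_range_aeval ℂ F]
      exact ⟨p, rfl⟩
    let q : Polynomial B := ∑ i : Fin n, Polynomial.monomial (i : ℕ)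
      (⟨aeval F (b i : MvPolynomial (Fin k) ℂ), hmem _⟩ : B)
    have hq : Polynomial.aeval h q = 0 := by
      simp only [q, map_sum, Polynomial.aeval_monomial]
      exact hb
    have hq0 : q = 0 := by
      by_contra hne
      have h1 := minpoly.IsIntegrallyClosed.degree_le_of_ne_zero hne hq
      have h2 : q.degree < n := by
        refine (Polynomial.degree_sum_le _ _).trans_lt ?_
        rw [Finset.sup_lt_iff (by exact WithBot.bot_lt_coe n)]
        intro i _
        refine (Polynomial.degree_monomial_le _ _).trans_lt ?_
        exact_mod_cast i.2
      have h3 := Polynomial.natDegree_le_natDegree h1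
      rw [Polynomial.degree_eq_natDegree hne] at h2
      have : q.natDegree < n := by exact_mod_cast h2
      omega
    funext i
    have hc : q.coeff i = ⟨aeval F (b i : MvPolynomial (Fin k) ℂ), hmem _⟩ := by
      simp only [q, Polynomial.finsetSum_coeff, Polynomial.coeff_monomial, Fin.val_inj]
      simp
    rw [hq0, Polynomial.coeff_zero] at hc
    have h4 : aeval F (b i : MvPolynomial (Fin k) ℂ) = 0 := (congrArg Subtype.val hc).symm
    exact Subtype.ext (hind (by simpa using h4))
  have hfin := LinearMap.finrank_le_finrank_of_injective hinj
  rwa [Module.finrank_pi_fintype, Finset.sum_const, Finset.card_univ, Fintype.card_fin,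
    smul_eq_mul, finrank_restrictTotalDegree hk, finrank_restrictTotalDegree hk] at hfin

/-- A linear form that vanishes on none of the finitely many nonzero differences separates the
points. -/
theorem exists_injOn_eval (s : Finset (Fin k → ℂ)) :
    ∃ h : MvPolynomial (Fin k) ℂ, Set.InjOn (fun z => eval z h) s := by
  obtain ⟨f, hf⟩ := Module.exists_dual_forall_apply_ne_zero (K := ℂ)
    (fun p : {p : s × s // p.1 ≠ p.2} => (p.1.1 : Fin k → ℂ) - p.1.2)
    (fun p => sub_ne_zero.2 fun h => p.2 (Subtype.ext h))
  refine ⟨∑ i, C (f (Pi.single i 1)) * X i, fun x hx y hy hxy => ?_⟩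
  have key : ∀ z : Fin k → ℂ, eval z (∑ i, C (f (Pi.single i 1)) * X i) = f z := by
    intro z
    conv_rhs => rw [pi_eq_sum_univ' z]
    simp [mul_comm]
  by_contra hne
  refine hf ⟨(⟨x, hx⟩, ⟨y, hy⟩), fun h => hne (congrArg Subtype.val h)⟩ ?_
  rw [map_sub, ← key, ← key, sub_eq_zero]
  exact hxy

/-- An affine form of Bézout's bound. -/
theorem card_le_pow_of_forall_eval_eq (hk : 1 ≤ k) (hd : 1 ≤ d)
    (F : Fin k → MvPolynomial (Fin k) ℂ) (hF : ∀ i, (F i).IsHomogeneous d)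
    (h0 : ∀ z : Fin k → ℂ, (∀ i, eval z (F i) = 0) → z = 0) (v : Fin k → ℂ)
    (s : Finset (Fin k → ℂ)) (hs : ∀ z ∈ s, ∀ i, eval z (F i) = v i) : s.card ≤ d ^ k := by
  classical
  obtain ⟨h, hh⟩ := exists_injOn_eval s
  have := finite_adjoin_of_forall_eq_zero hd F hF h0
  refine le_trans ?_ (natDegree_minpoly_le hk hd F hF h0 h)
  have hind := algebraicIndependent_of_forall_eq_zero hd F hF h0
  set B := Algebra.adjoin ℂ (Set.range F) with hB
  have hint : IsIntegral B h := Algebra.IsIntegral.isIntegral h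
  have hmonic := minpoly.monic hint
  -- Specialisation `F = v`, well defined because the `F i` are algebraically independent. It agrees
  -- with evaluation at every point of `s`, so the values of `h` on `s` are roots of one specialised
  -- minimal polynomial.
  let ev : B →+* ℂ := ((aeval v).comp hind.aevalEquiv.symm.toAlgHom).toRingHom
  have hev : ∀ z ∈ s, ∀ b : B, ev b = eval z (b : MvPolynomial (Fin k) ℂ) := by
    intro z hz b
    obtain ⟨p, rfl⟩ := hind.aevalEquiv.surjective b
    have h1 : ev (hind.aevalEquiv p) = aeval v p := by simp [ev]
    rw [h1, AlgebraicIndependent.aevalEquiv_apply_coe]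
    have h2 : aeval v p = aeval (fun i => eval z (F i)) p := by
      rw [show (fun i => eval z (F i)) = v from _root_.funext fun i => hs z hz i]
    rw [h2]
    have h3 : (aeval z).comp (aeval F) = (aeval fun i => eval z (F i) :
        MvPolynomial (Fin k) ℂ →ₐ[ℂ] ℂ) := by
      ext i
      simp [aeval_def]
    rw [← h3]
    simp
  rw [← hmonic.natDegree_map ev, ← Finset.card_image_of_injOn hh]
  refine Polynomial.card_le_degree_of_subset_roots fun y hy => ?_
  rw [Finset.mem_val, Finset.mem_image] at hy
  obtain ⟨z, hz, rfl⟩ := hy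
  rw [Polynomial.mem_roots (hmonic.map ev).ne_zero, Polynomial.IsRoot, Polynomial.eval_map]
  have h1 := congrArg (eval z) (minpoly.aeval B h)
  rw [Polynomial.aeval_def, Polynomial.hom_eval₂, map_zero] at h1
  rw [← h1]
  congr 1
  ext b
  exact hev z hz b

end MvPolynomial

/-! ### Topology of complex projective space -/

namespace CP

variable {m : ℕ}

theorem isQuotientMap_mk : Topology.IsQuotientMap
    (fun v : {v : Fin m → ℂ // v ≠ 0} => (Projectivization.mk ℂ v.1 v.2 : CP m)) :=
  ⟨⟨rfl⟩, fun p => ⟨⟨p.rep, p.rep_nonzero⟩, p.mk_rep⟩⟩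

theorem continuous_mk {α : Type*} [TopologicalSpace α] {g : α → Fin m → ℂ} (hg : Continuous g)
    (h0 : ∀ a, g a ≠ 0) : Continuous fun a => (Projectivization.mk ℂ (g a) (h0 a) : CP m) :=
  isQuotientMap_mk.continuous.comp (hg.subtype_mk h0)

/-- The rank one matrix `v v* / ‖v‖ ^ 2` attached to the line through `v`. -/
def toMatrix : CP m → Fin m → Fin m → ℂ :=
  Projectivization.lift (fun v i j => v.1 i * starRingEnd ℂ (v.1 j) / (‖v.1‖ : ℂ) ^ 2) (by
    rintro ⟨v, hv⟩ ⟨w, hw⟩ t (rfl : v = t • w)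
    have ht : t ≠ 0 := fun h => hv (by simp [h])
    have hw' : (‖w‖ : ℂ) ≠ 0 := by simpa using hw
    have ht' : (‖t‖ : ℂ) ≠ 0 := by simpa using ht
    funext i j
    have : t * starRingEnd ℂ t = (‖t‖ : ℂ) ^ 2 := Complex.mul_conj' t
    simp only [Pi.smul_apply, smul_eq_mul, map_mul, norm_smul, Complex.ofReal_mul]
    field_simp
    linear_combination (w i * starRingEnd ℂ (w j)) * this)

theorem continuous_toMatrix : Continuous (toMatrix : CP m → _) := by
  refine isQuotientMap_mk.continuous_iff.2 ?_
  refine continuous_pi fun i => continuous_pi fun j => ?_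
  change Continuous fun v : {v : Fin m → ℂ // v ≠ 0} =>
    v.1 i * starRingEnd ℂ (v.1 j) / (‖v.1‖ : ℂ) ^ 2
  refine Continuous.div₀ (Continuous.mul
    ((continuous_apply i).comp continuous_subtype_val)
    (Complex.continuous_conj.comp ((continuous_apply j).comp continuous_subtype_val)))
    (by fun_prop) fun v => ?_
  simpa using v.2

/-- Any nonzero column of `v v*` is a multiple of `v` and hence recovers the line. -/
theorem toMatrix_injective : Function.Injective (toMatrix : CP m → _) := by
  intro p q h
  induction p using Projectivization.ind with | h v hv => ?_
  induction q using Projectivization.ind with | h w hw => ?_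
  have h' : ∀ i j, v i * starRingEnd ℂ (v j) / (‖v‖ : ℂ) ^ 2 =
      w i * starRingEnd ℂ (w j) / (‖w‖ : ℂ) ^ 2 := fun i j => congrFun (congrFun h i) j
  have hv' : (‖v‖ : ℂ) ≠ 0 := by simpa using hv
  have hw' : (‖w‖ : ℂ) ≠ 0 := by simpa using hw
  obtain ⟨j, hj⟩ := Function.ne_iff.1 hv
  have hj' : starRingEnd ℂ (v j) ≠ 0 := by simpa using hj
  rw [Projectivization.mk_eq_mk_iff']
  refine ⟨starRingEnd ℂ (w j) * (‖v‖ : ℂ) ^ 2 / ((‖w‖ : ℂ) ^ 2 * starRingEnd ℂ (v j)), ?_⟩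
  funext i
  have := h' i j
  simp only [Pi.smul_apply, smul_eq_mul]
  field_simp at this ⊢
  linear_combination -this

instance : T2Space (CP m) :=
  T2Space.of_injective_continuous toMatrix_injective continuous_toMatrix

theorem exists_norm_eq_one (p : CP m) :
    ∃ (v : Fin m → ℂ) (hv : v ≠ 0), ‖v‖ = 1 ∧ Projectivization.mk ℂ v hv = p := by
  have h := p.rep_nonzero
  have hn : (‖p.rep‖ : ℂ)⁻¹ ≠ 0 := by simpa using h
  refine ⟨(‖p.rep‖ : ℂ)⁻¹ • p.rep, smul_ne_zero hn h, ?_, ?_⟩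
  · rw [norm_smul]
    simp [h]
  · conv_rhs => rw [← p.mk_rep]
    rw [Projectivization.mk_eq_mk_iff']
    exact ⟨_, rfl⟩

instance : CompactSpace (CP m) := by
  have hc : CompactSpace (Metric.sphere (0 : Fin m → ℂ) 1) :=
    isCompact_iff_compactSpace.1 (isCompact_sphere _ _)
  have h0 : ∀ v : Metric.sphere (0 : Fin m → ℂ) 1, (v : Fin m → ℂ) ≠ 0 := fun v h => by
    have := v.2
    simp [h] at this
  have hcont := continuous_mk continuous_subtype_val h0
  refine ⟨?_⟩
  convert isCompact_range hcont
  refine (Set.eq_univ_of_forall fun p => ?_).symm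
  obtain ⟨v, hv, h1, h2⟩ := exists_norm_eq_one p
  exact ⟨⟨v, by simpa using h1⟩, h2⟩

end CP

theorem continuous_projMap {n m d : ℕ} (P : Fin m → MvPolynomial (Fin n) ℂ)
    (hP : ∀ i, (P i).IsHomogeneous d)
    (h0 : ∀ z : Fin n → ℂ, (∀ i, MvPolynomial.eval z (P i) = 0) → z = 0) :
    Continuous (projMap P hP h0) := by
  refine CP.isQuotientMap_mk.continuous_iff.2 ?_
  refine CP.continuous_mk (g := fun z : {z : Fin n → ℂ // z ≠ 0} =>
    fun i => MvPolynomial.eval z.1 (P i)) ?_ _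
  exact continuous_pi fun i => (MvPolynomial.continuous_eval (P i)).comp continuous_subtype_val

/-! ### Lifts to affine space and Bézout's bound for the fibres of `f_∞`. -/

namespace PencilPair

variable {k d : ℕ} (f : PencilPair k d)

theorem continuous_fInf : Continuous f.fInf := continuous_projMap _ _ _

theorem continuous_fPlus : Continuous f.fPlus := continuous_projMap _ _ _

theorem continuous_fEps (ε : ℂ) : Continuous (f.fEps ε) := continuous_projMap _ _ _

theorem degree_ne_zero {k d : ℕ} (f : PencilPair k d) : d ≠ 0 := by
  have := f.two_le_degree
  omega

/-- The lift `F` of `f_∞` to `ℂ ^ k`. -/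
def lift (z : Fin k → ℂ) : Fin k → ℂ := fun i => MvPolynomial.eval z (f.F i)

/-- The polynomial function `R` on `ℂ ^ k`. -/
def res (z : Fin k → ℂ) : ℂ := MvPolynomial.eval z f.R

theorem continuous_lift : Continuous f.lift :=
  continuous_pi fun i => MvPolynomial.continuous_eval (f.F i)

theorem continuous_res : Continuous f.res := MvPolynomial.continuous_eval f.R

theorem lift_smul (t : ℂ) (z : Fin k → ℂ) : f.lift (t • z) = t ^ d • f.lift z :=
  funext fun i => eval_smul_of_isHomogeneous (f.isHomogeneous_F i) t z

theorem res_smul (t : ℂ) (z : Fin k → ℂ) : f.res (t • z) = t ^ d * f.res z :=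
  eval_smul_of_isHomogeneous f.isHomogeneous_R t z

theorem lift_ne_zero {z : Fin k → ℂ} (hz : z ≠ 0) : f.lift z ≠ 0 := fun h =>
  hz (f.eq_zero_of_eval_F z fun i => congrFun h i)

theorem lift_zero : f.lift 0 = 0 := by
  simpa [f.degree_ne_zero] using f.lift_smul 0 0

theorem ne_zero_of_lift_ne_zero {z : Fin k → ℂ} (hz : f.lift z ≠ 0) : z ≠ 0 := by
  rintro rfl
  exact hz f.lift_zero

theorem fInf_mk_eq (z : Fin k → ℂ) (hz : z ≠ 0) :
    f.fInf (Projectivization.mk ℂ z hz) = Projectivization.mk ℂ (f.lift z) (f.lift_ne_zero hz) :=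
  rfl

theorem snoc_ne_zero {z : Fin k → ℂ} (hz : z ≠ 0) (u : ℂ) :
    (Fin.snoc z u : Fin (k + 1) → ℂ) ≠ 0 := fun h =>
  hz (funext fun i => by simpa using congrFun h i.castSucc)

theorem fPlus_mk_eq (z : Fin k → ℂ) (hz : z ≠ 0) :
    f.fPlus (Projectivization.mk ℂ z hz) =
      Projectivization.mk ℂ (Fin.snoc (f.lift z) (f.res z) : Fin (k + 1) → ℂ)
        (snoc_ne_zero (f.lift_ne_zero hz) _) := by
  have key : ∀ (a b : Fin (k + 1) → ℂ) (ha : a ≠ 0) (hb : b ≠ 0), a = b →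
      Projectivization.mk ℂ a ha = Projectivization.mk ℂ b hb := by
    rintro a _ ha _ rfl; rfl
  refine key _ _ _ _ ?_
  funext j
  refine Fin.lastCases ?_ (fun i => ?_) j <;> simp [lift, res]

theorem fEps_mk_eq (ε : ℂ) (z : Fin k → ℂ) (hz : z ≠ 0) (u : ℂ) :
    f.fEps ε (Projectivization.mk ℂ (Fin.snoc z u : Fin (k + 1) → ℂ) (snoc_ne_zero hz u)) =
      Projectivization.mk ℂ (Fin.snoc (f.lift z) (u ^ d + ε * f.res z) : Fin (k + 1) → ℂ)
        (snoc_ne_zero (f.lift_ne_zero hz) _) := by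
  have key : ∀ (a b : Fin (k + 1) → ℂ) (ha : a ≠ 0) (hb : b ≠ 0), a = b →
      Projectivization.mk ℂ a ha = Projectivization.mk ℂ b hb := by
    rintro a _ ha _ rfl; rfl
  refine key _ _ _ _ ?_
  funext j
  refine Fin.lastCases ?_ (fun i => ?_) j <;>
    simp [lift, res, MvPolynomial.eval_rename, Function.comp_def]

theorem snoc_eq_smul_snoc_iff {z w : Fin k → ℂ} {a b t : ℂ} :
    t • (Fin.snoc w b : Fin (k + 1) → ℂ) = Fin.snoc z a ↔ t • w = z ∧ t * b = a := by
  constructor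
  · intro h
    exact ⟨funext fun i => by simpa using congrFun h i.castSucc,
      by simpa using congrFun h (Fin.last k)⟩
  · rintro ⟨rfl, rfl⟩
    funext j
    refine Fin.lastCases ?_ (fun i => ?_) j <;> simp

/-- A point of a fibre of `f_∞` has a representative in a given fibre of the lift. -/
theorem exists_lift_eq (z : CP k) (a : Fin k → ℂ) (ha : a ≠ 0)
    (h : f.fInf z = Projectivization.mk ℂ a ha) :
    ∃ (v : Fin k → ℂ) (hv : v ≠ 0), Projectivization.mk ℂ v hv = z ∧ f.lift v = a := by
  induction z using Projectivization.ind with | h v hv => ?_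
  rw [fInf_mk_eq, Projectivization.mk_eq_mk_iff'] at h
  obtain ⟨t, ht⟩ := h
  have ht0 : t ≠ 0 := by
    rintro rfl
    exact f.lift_ne_zero hv (by simpa using ht.symm)
  obtain ⟨s, hs⟩ := IsAlgClosed.exists_pow_nat_eq t⁻¹ (Nat.pos_of_ne_zero f.degree_ne_zero)
  have hs0 : s ≠ 0 := by
    rintro rfl
    rw [zero_pow f.degree_ne_zero] at hs
    exact inv_ne_zero ht0 hs.symm
  refine ⟨s • v, smul_ne_zero hs0 hv, ?_, ?_⟩
  · rw [Projectivization.mk_eq_mk_iff']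
    exact ⟨s, rfl⟩
  · rw [lift_smul, hs, ← ht, smul_smul, inv_mul_cancel₀ ht0, one_smul]

/-- Bézout's bound for the fibres of `f_∞`. -/
theorem encard_fInf_fiber_le (hk : 1 ≤ k) (q : CP k) :
    (f.fInf ⁻¹' {q}).encard ≤ (d ^ (k - 1) : ℕ) := by
  classical
  by_contra! hlt
  obtain ⟨t, ht, htc⟩ := Set.exists_subset_encard_eq (Order.add_one_le_of_lt hlt)
  have htf : t.Finite := Set.finite_of_encard_le_coe (k := d ^ (k - 1) + 1) (by
    rw [htc]; norm_cast)
  obtain ⟨T, rfl⟩ := htf.exists_finset_coe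
  rw [Set.encard_coe_eq_coe_finsetCard] at htc
  have hcard : T.card = d ^ (k - 1) + 1 := by exact_mod_cast htc
  induction q using Projectivization.ind with | h a ha => ?_
  have hex : ∀ z : CP k, ∃ v : Fin k → ℂ, z ∈ T →
      ∃ hv : v ≠ 0, Projectivization.mk ℂ v hv = z ∧ f.lift v = a := by
    intro z
    by_cases hz : z ∈ T
    · obtain ⟨v, hv⟩ := f.exists_lift_eq z a ha (ht hz)
      exact ⟨v, fun _ => hv⟩
    · exact ⟨0, fun h => absurd h hz⟩
  choose v hv using hex
  have hdpos := Nat.pos_of_ne_zero f.degree_ne_zero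
  set Z := Polynomial.nthRootsFinset d (1 : ℂ)
  have hZ : Z.card = d := (Complex.isPrimitiveRoot_exp d f.degree_ne_zero).card_nthRootsFinset
  -- Each projective point of the fibre contributes `d` solutions of `F z = a`, its representatives
  -- differing by `d`-th roots of unity. This divides the affine bound `d ^ k` by `d`.
  have hinj : Set.InjOn (fun p : CP k × ℂ => p.2 • v p.1) (T ×ˢ Z : Finset (CP k × ℂ)) := by
    rintro ⟨z, s⟩ hzs ⟨w, t⟩ hwt h
    simp only [Finset.coe_product, Set.mem_prod, Finset.mem_coe] at hzs hwt
    obtain ⟨hv0, hvz, -⟩ := hv z hzs.1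
    obtain ⟨hw0, hvw, -⟩ := hv w hwt.1
    have hs := (Polynomial.mem_nthRootsFinset hdpos _).1 hzs.2
    have hs0 : s ≠ 0 := by
      rintro rfl
      simp [f.degree_ne_zero] at hs
    simp only at h
    have hzw : z = w := by
      rw [← hvz, ← hvw, Projectivization.mk_eq_mk_iff']
      refine ⟨s⁻¹ * t, ?_⟩
      rw [mul_smul, ← h, smul_smul, inv_mul_cancel₀ hs0, one_smul]
    subst hzw
    rw [smul_left_injective ℂ hv0 h]
  have hle := MvPolynomial.card_le_pow_of_forall_eval_eq hk hdpos f.F f.isHomogeneous_F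
    f.eq_zero_of_eval_F a ((T ×ˢ Z).image fun p : CP k × ℂ => p.2 • v p.1) (by
      intro z hz i
      obtain ⟨⟨w, s⟩, hws, rfl⟩ := Finset.mem_image.1 hz
      rw [Finset.mem_product] at hws
      obtain ⟨-, -, h⟩ := hv w hws.1
      have hs := (Polynomial.mem_nthRootsFinset hdpos _).1 hws.2
      have := congrFun (f.lift_smul s (v w)) i
      rw [hs, one_smul, h] at this
      exact this)
  rw [Finset.card_image_of_injOn hinj, Finset.card_product, hZ, hcard] at hle
  have hpow : d ^ k = d ^ (k - 1) * d := by
    rw [← pow_succ, Nat.sub_add_cancel hk]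
  rw [hpow] at hle
  have := Nat.le_of_mul_le_mul_right hle hdpos
  omega

end PencilPair

/-! ### Trapping regions -/

section Trapping

variable {α : Type*} {g : α → α} {U V W : Set α}

theorem iterate_image_subset_of_image_subset (h : g '' U ⊆ V) (n : ℕ) :
    g^[n + 1] '' U ⊆ g^[n] '' V := by
  rw [Function.iterate_succ, Set.image_comp]
  exact Set.image_mono h

theorem iInter_iterate_image_eq (h : g '' U ⊆ V) (hVU : V ⊆ U) :
    ⋂ n : ℕ, g^[n] '' V = ⋂ n : ℕ, g^[n] '' U := by
  refine Set.Subset.antisymm (Set.iInter_mono fun n => Set.image_mono hVU) ?_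
  exact Set.subset_iInter fun n => (Set.iInter_subset _ (n + 1)).trans
    (iterate_image_subset_of_image_subset h n)

variable [TopologicalSpace α]

theorem isTrappingRegion_of_subset (hV : IsClosed V) (hW : IsOpen W) (h : g '' U ⊆ V)
    (hVW : V ⊆ W) (hWU : W ⊆ U) : IsTrappingRegion g (⋂ n : ℕ, g^[n] '' U) U :=
  ⟨(closure_minimal h hV).trans (hVW.trans (interior_maximal hWU hW)), rfl⟩

theorem isTrappingRegion_open_of_subset (hV : IsClosed V) (hW : IsOpen W) (h : g '' U ⊆ V)
    (hVW : V ⊆ W) (hWU : W ⊆ U) : IsTrappingRegion g (⋂ n : ℕ, g^[n] '' U) W :=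
  ⟨by
    rw [hW.interior_eq]
    exact (closure_minimal ((Set.image_mono hWU).trans h) hV).trans hVW,
    (iInter_iterate_image_eq (h.trans hVW) hWU).symm⟩

theorem isAttractingSet_of_subset [CompactSpace α] [T2Space α] (hg : Continuous g)
    (hU : IsClosed U) (hV : IsClosed V) (hW : IsOpen W) (h : g '' U ⊆ V)
    (hVW : V ⊆ W) (hWU : W ⊆ U) : IsAttractingSet g (⋂ n : ℕ, g^[n] '' U) := by
  refine ⟨?_, W, hW, ?_, isTrappingRegion_open_of_subset hV hW h hVW hWU⟩
  · refine IsClosed.isCompact (isClosed_iInter fun n => ?_)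
    exact (hU.isCompact.image (hg.iterate n)).isClosed
  · refine (Set.iInter_subset _ 1).trans ?_
    simpa using h.trans hVW

end Trapping

/-! ### The tubes in the coordinates `[z : ε u]`: trapping and the star-shape condition. -/

namespace PencilPair

variable {k d : ℕ} (f : PencilPair k d)

/-- The open set of the `[z_0 : ⋯ : z_k]` with `|z_k| < c |ε| max (|z_0|, …, |z_{k-1}|)`. -/
def openU (_f : PencilPair k d) (c : ℝ) (ε : ℂ) : Set (CP (k + 1)) :=
  {z | ‖z.rep (Fin.last k)‖ < c * ‖ε‖ * ‖fun i : Fin k => z.rep i.castSucc‖}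

theorem mk_mem_U_iff (c : ℝ) (ε : ℂ) (v : Fin (k + 1) → ℂ) (hv : v ≠ 0) :
    Projectivization.mk ℂ v hv ∈ f.U c ε ↔
      ‖v (Fin.last k)‖ ≤ c * ‖ε‖ * ‖fun i : Fin k => v i.castSucc‖ := by
  obtain ⟨a, ha⟩ := Projectivization.exists_smul_eq_mk_rep ℂ v hv
  have ha0 : 0 < ‖(a : ℂ)‖ := norm_pos_iff.2 a.ne_zero
  have hsm : (fun i : Fin k => (a • v) i.castSucc) = (a : ℂ) • fun i : Fin k => v i.castSucc := rfl
  have hl : (a • v) (Fin.last k) = (a : ℂ) • v (Fin.last k) := rfl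
  rw [U, Set.mem_ofPred_eq, ← ha, hsm, hl, norm_smul, norm_smul, mul_left_comm,
    mul_le_mul_iff_right₀ ha0]

theorem mk_mem_openU_iff (c : ℝ) (ε : ℂ) (v : Fin (k + 1) → ℂ) (hv : v ≠ 0) :
    Projectivization.mk ℂ v hv ∈ f.openU c ε ↔
      ‖v (Fin.last k)‖ < c * ‖ε‖ * ‖fun i : Fin k => v i.castSucc‖ := by
  obtain ⟨a, ha⟩ := Projectivization.exists_smul_eq_mk_rep ℂ v hv
  have ha0 : 0 < ‖(a : ℂ)‖ := norm_pos_iff.2 a.ne_zero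
  have hsm : (fun i : Fin k => (a • v) i.castSucc) = (a : ℂ) • fun i : Fin k => v i.castSucc := rfl
  have hl : (a • v) (Fin.last k) = (a : ℂ) • v (Fin.last k) := rfl
  rw [openU, Set.mem_ofPred_eq, ← ha, hsm, hl, norm_smul, norm_smul, mul_left_comm,
    mul_lt_mul_iff_right₀ ha0]

theorem continuous_norm_last : Continuous fun v : {v : Fin (k + 1) → ℂ // v ≠ 0} =>
    ‖v.1 (Fin.last k)‖ :=
  ((continuous_apply _).comp continuous_subtype_val).norm

theorem continuous_norm_castSucc : Continuous fun v : {v : Fin (k + 1) → ℂ // v ≠ 0} =>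
    ‖fun i : Fin k => v.1 i.castSucc‖ :=
  (continuous_pi fun i : Fin k =>
    (continuous_apply i.castSucc).comp continuous_subtype_val).norm

theorem isClosed_U (c : ℝ) (ε : ℂ) : IsClosed (f.U c ε) := by
  rw [← CP.isQuotientMap_mk.isClosed_preimage]
  have : (fun v : {v : Fin (k + 1) → ℂ // v ≠ 0} => (Projectivization.mk ℂ v.1 v.2 : CP (k + 1)))
      ⁻¹' f.U c ε = {v | ‖v.1 (Fin.last k)‖ ≤ c * ‖ε‖ * ‖fun i : Fin k => v.1 i.castSucc‖} :=
    Set.ext fun v => f.mk_mem_U_iff c ε v.1 v.2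
  rw [this]
  exact isClosed_le continuous_norm_last (continuous_const.mul continuous_norm_castSucc)

theorem isOpen_openU (c : ℝ) (ε : ℂ) : IsOpen (f.openU c ε) := by
  rw [← CP.isQuotientMap_mk.isOpen_preimage]
  have : (fun v : {v : Fin (k + 1) → ℂ // v ≠ 0} => (Projectivization.mk ℂ v.1 v.2 : CP (k + 1)))
      ⁻¹' f.openU c ε = {v | ‖v.1 (Fin.last k)‖ < c * ‖ε‖ * ‖fun i : Fin k => v.1 i.castSucc‖} :=
    Set.ext fun v => f.mk_mem_openU_iff c ε v.1 v.2
  rw [this]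
  exact isOpen_lt continuous_norm_last (continuous_const.mul continuous_norm_castSucc)

theorem openU_subset_U (c : ℝ) (ε : ℂ) : f.openU c ε ⊆ f.U c ε := by
  intro p hp
  rw [openU, Set.mem_ofPred_eq] at hp
  rw [U, Set.mem_ofPred_eq]
  exact hp.le

theorem mk_snoc_mem_U_iff {c : ℝ} {ε : ℂ} (hε : ε ≠ 0) (z : Fin k → ℂ) (hz : z ≠ 0) (u : ℂ) :
    Projectivization.mk ℂ (Fin.snoc z (ε * u) : Fin (k + 1) → ℂ) (snoc_ne_zero hz _) ∈ f.U c ε ↔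
      ‖u‖ ≤ c * ‖z‖ := by
  rw [mk_mem_U_iff]
  simp only [Fin.snoc_last, Fin.snoc_castSucc, norm_mul]
  rw [mul_comm c, mul_assoc, mul_le_mul_iff_right₀ (norm_pos_iff.2 hε)]

theorem exists_snoc_of_mem_U {c : ℝ} {ε : ℂ} (hε : ε ≠ 0) {p : CP (k + 1)} (hp : p ∈ f.U c ε) :
    ∃ (z : Fin k → ℂ) (hz : z ≠ 0) (u : ℂ), ‖u‖ ≤ c * ‖z‖ ∧
      p = Projectivization.mk ℂ (Fin.snoc z (ε * u) : Fin (k + 1) → ℂ) (snoc_ne_zero hz _) := by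
  induction p using Projectivization.ind with | h v hv => ?_
  have hv' : v = Fin.snoc (fun i : Fin k => v i.castSucc) (ε * (ε⁻¹ * v (Fin.last k))) := by
    funext j
    refine Fin.lastCases ?_ (fun i => ?_) j
    · rw [Fin.snoc_last, mul_inv_cancel_left₀ hε]
    · rw [Fin.snoc_castSucc (α := fun _ => ℂ)]
  have hz : (fun i : Fin k => v i.castSucc) ≠ 0 := by
    intro h
    rw [mk_mem_U_iff, h, norm_zero, mul_zero, norm_le_zero_iff] at hp
    exact hv (by rw [hv', h, hp]; funext j; refine Fin.lastCases ?_ (fun i => ?_) j <;> simp)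
  have hEq : Projectivization.mk ℂ v hv = Projectivization.mk ℂ
      (Fin.snoc (fun i : Fin k => v i.castSucc) (ε * (ε⁻¹ * v (Fin.last k))) : Fin (k + 1) → ℂ)
      (snoc_ne_zero hz _) := by
    rw [Projectivization.mk_eq_mk_iff']
    exact ⟨1, by rw [one_smul, ← hv']⟩
  refine ⟨_, hz, ε⁻¹ * v (Fin.last k), ?_, hEq⟩
  rwa [hEq, mk_snoc_mem_U_iff f hε _ hz] at hp

/-- The action of `f_ε` in the coordinates `[z : ε u]`. -/
theorem fEps_mk_snoc (ε : ℂ) (z : Fin k → ℂ) (hz : z ≠ 0) (u : ℂ) :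
    f.fEps ε (Projectivization.mk ℂ (Fin.snoc z (ε * u) : Fin (k + 1) → ℂ) (snoc_ne_zero hz _)) =
      Projectivization.mk ℂ
        (Fin.snoc (f.lift z) (ε * (f.res z + ε ^ (d - 1) * u ^ d)) : Fin (k + 1) → ℂ)
        (snoc_ne_zero (f.lift_ne_zero hz) _) := by
  rw [fEps_mk_eq f ε z hz, Projectivization.mk_eq_mk_iff']
  refine ⟨1, ?_⟩
  rw [one_smul]
  congr 1
  have : ε ^ d = ε * ε ^ (d - 1) := by
    rw [← pow_succ', Nat.sub_add_cancel (Nat.pos_of_ne_zero f.degree_ne_zero)]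
  rw [mul_pow, this]
  ring

/-- By homogeneity it suffices to bound `‖F‖` below and `|R|` above on the unit sphere, which is
compact and on which `F` does not vanish. -/
theorem exists_bounds : ∃ m M : ℝ, 0 < m ∧ 0 ≤ M ∧
    ∀ z, m * ‖z‖ ^ d ≤ ‖f.lift z‖ ∧ ‖f.res z‖ ≤ M * ‖z‖ ^ d := by
  have hsph := isCompact_sphere (0 : Fin k → ℂ) 1
  obtain ⟨M, hM⟩ := hsph.exists_bound_of_continuousOn f.continuous_res.continuousOn
  have h0 : ∀ z ∈ Metric.sphere (0 : Fin k → ℂ) 1, ‖f.lift z‖ ≠ 0 := fun z hz => by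
    rw [norm_ne_zero_iff]
    exact f.lift_ne_zero (ne_zero_of_mem_unit_sphere ⟨z, hz⟩)
  obtain ⟨C, hC⟩ := hsph.exists_bound_of_continuousOn
    (f.continuous_lift.norm.continuousOn.inv₀ h0)
  have hCpos : 0 < max C 1 := lt_max_of_lt_right one_pos
  refine ⟨(max C 1)⁻¹, max M 0, inv_pos.2 hCpos, le_max_right _ _, fun z => ?_⟩
  by_cases hz : z = 0
  · subst hz
    have := f.res_smul 0 0
    rw [smul_zero, zero_pow f.degree_ne_zero, zero_mul] at this
    simp [this, f.degree_ne_zero]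
  have hzn : 0 < ‖z‖ := norm_pos_iff.2 hz
  obtain ⟨w, hw, hzw⟩ : ∃ w ∈ Metric.sphere (0 : Fin k → ℂ) 1, z = (‖z‖ : ℂ) • w := by
    refine ⟨(‖z‖ : ℂ)⁻¹ • z, ?_, ?_⟩
    · rw [mem_sphere_zero_iff_norm, norm_smul]
      simp [hz]
    · rw [smul_smul, mul_inv_cancel₀ (by simpa using hz), one_smul]
  have hn : ‖(‖z‖ : ℂ) ^ d‖ = ‖z‖ ^ d := by simp
  have h1 : ‖f.lift z‖ = ‖z‖ ^ d * ‖f.lift w‖ := by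
    conv_lhs => rw [hzw, lift_smul, norm_smul, hn]
  have h2 : ‖f.res z‖ = ‖z‖ ^ d * ‖f.res w‖ := by
    conv_lhs => rw [hzw, res_smul, norm_mul, hn]
  constructor
  · rw [h1, mul_comm]
    gcongr
    have h3 := hC w hw
    have h4 : 0 < ‖f.lift w‖ := lt_of_le_of_ne (norm_nonneg _) (h0 w hw).symm
    rw [Pi.inv_apply, norm_inv, norm_norm] at h3
    exact inv_le_of_inv_le₀ h4 (h3.trans (le_max_left _ _))
  · rw [h2, mul_comm]
    gcongr
    exact (hM w hw).trans (le_max_left _ _)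

/-- The new fibre coordinate is `R z + ε ^ (d - 1) u ^ d`, of size at most `(M + ‖ε‖ ^ (d - 1) c ^
d) ‖z‖ ^ d`, while the new base vector has norm at least `m ‖z‖ ^ d`. -/
theorem image_U_subset {m M c c' : ℝ} {ε : ℂ} (hε : ε ≠ 0) (hc' : 0 ≤ c')
    (hmM : ∀ z, m * ‖z‖ ^ d ≤ ‖f.lift z‖ ∧ ‖f.res z‖ ≤ M * ‖z‖ ^ d)
    (h : M + ‖ε‖ ^ (d - 1) * c ^ d ≤ c' * m) : f.fEps ε '' f.U c ε ⊆ f.U c' ε := by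
  rintro _ ⟨p, hp, rfl⟩
  obtain ⟨z, hz, u, hu, rfl⟩ := f.exists_snoc_of_mem_U hε hp
  rw [fEps_mk_snoc f ε z hz, mk_snoc_mem_U_iff f hε _ (f.lift_ne_zero hz)]
  calc ‖f.res z + ε ^ (d - 1) * u ^ d‖ ≤ M * ‖z‖ ^ d + ‖ε‖ ^ (d - 1) * (c * ‖z‖) ^ d := by
        refine (norm_add_le _ _).trans (add_le_add (hmM z).2 ?_)
        rw [norm_mul, norm_pow, norm_pow]
        gcongr
    _ = (M + ‖ε‖ ^ (d - 1) * c ^ d) * ‖z‖ ^ d := by ring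
    _ ≤ c' * m * ‖z‖ ^ d := by gcongr
    _ = c' * (m * ‖z‖ ^ d) := by ring
    _ ≤ c' * ‖f.lift z‖ := by gcongr; exact (hmM z).1

theorem U_subset_openU {c c' : ℝ} {ε : ℂ} (hε : ε ≠ 0) (h : c' < c) :
    f.U c' ε ⊆ f.openU c ε := by
  intro p hp
  obtain ⟨z, hz, u, hu, rfl⟩ := f.exists_snoc_of_mem_U hε hp
  rw [mk_mem_openU_iff]
  simp only [Fin.snoc_last, Fin.snoc_castSucc, norm_mul]
  rw [mul_comm c, mul_assoc]
  refine mul_lt_mul_of_pos_left (hu.trans_lt ?_) (norm_pos_iff.2 hε)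
  exact mul_lt_mul_of_pos_right h (norm_pos_iff.2 hz)

/-- The centre `I` is `[0 : ⋯ : 0 : 1]` and `L` is the hyperplane `z_k = 0`. On a line through `I`
the first `k` coordinates are fixed, and the tube is a disc in the last one. -/
theorem satisfiesHD_U (hk : 1 ≤ k) {c : ℝ} (hc : 0 ≤ c) (ε : ℂ) : SatisfiesHD 1 (f.U c ε) := by
  have hlast : ∀ {v : Fin (k + 1) → ℂ}, (fun i : Fin k => v i.castSucc) = 0 →
      v (Fin.last k) = 0 → v = 0 := by
    intro v h1 h2
    funext j
    exact Fin.lastCases (motive := fun j => v j = 0) h2 (fun i => congrFun h1 i) j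
  refine ⟨le_rfl, hk, Submodule.span ℂ {Pi.single (Fin.last k) 1},
    LinearMap.ker (LinearMap.proj (R := ℂ) (φ := fun _ : Fin (k + 1) => ℂ) (Fin.last k)),
    finrank_span_singleton (by simp), ?_, ?_, ?_, ?_⟩
  · have h1 := LinearMap.finrank_range_add_finrank_ker
      (LinearMap.proj (R := ℂ) (φ := fun _ : Fin (k + 1) => ℂ) (Fin.last k))
    rw [LinearMap.range_eq_top.2 (LinearMap.proj_surjective _), finrank_top] at h1
    simp only [Module.finrank_self, Module.finrank_fin_fun] at h1
    omega
  · intro v hv hvI hU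
    obtain ⟨a, rfl⟩ := Submodule.mem_span_singleton.1 hvI
    rw [mk_mem_U_iff] at hU
    have h0 : (fun i : Fin k => (a • (Pi.single (Fin.last k) 1 : Fin (k + 1) → ℂ)) i.castSucc)
        = 0 := by
      funext i
      simp
    rw [h0, norm_zero, mul_zero, norm_le_zero_iff] at hU
    exact hv (hlast h0 hU)
  · intro x hx hxL
    rw [LinearMap.mem_ker, LinearMap.proj_apply] at hxL
    rw [mk_mem_U_iff, hxL, norm_zero]
    positivity
  · intro x hxL _ v hvI t ht0 ht1 h h' hU
    rw [LinearMap.mem_ker, LinearMap.proj_apply] at hxL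
    obtain ⟨a, rfl⟩ := Submodule.mem_span_singleton.1 hvI
    rw [mk_mem_U_iff] at hU ⊢
    have h1 : ∀ b : ℂ, (fun i : Fin k =>
        (x + b • a • (Pi.single (Fin.last k) 1 : Fin (k + 1) → ℂ)) i.castSucc) =
        fun i => x i.castSucc := by
      intro b
      funext i
      simp
    have h2 := h1 1
    rw [one_smul] at h2
    rw [h1]
    rw [h2] at hU
    refine le_trans ?_ hU
    simp only [Pi.add_apply, hxL, Pi.smul_apply, Pi.single_eq_same, smul_eq_mul, zero_add,
      mul_one, norm_mul, Complex.norm_real, Real.norm_of_nonneg ht0]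
    exact mul_le_of_le_one_left (norm_nonneg _) ht1

end PencilPair

/-! ### Counting backward orbits -/

theorem Set.Finite.ncard_biUnion_le_mul {α β : Type*} {T : Set α} (hT : T.Finite) {S : α → Set β}
    {K : ℝ} (hS : ∀ y ∈ T, (S y).Finite ∧ ((S y).ncard : ℝ) ≤ K) :
    (⋃ y ∈ T, S y).Finite ∧ ((⋃ y ∈ T, S y).ncard : ℝ) ≤ T.ncard * K := by
  refine ⟨hT.biUnion fun y hy => (hS y hy).1, ?_⟩
  lift T to Finset α using hT
  have h := Finset.set_ncard_biUnion_le T S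
  calc ((⋃ y ∈ (T : Set α), S y).ncard : ℝ) ≤ ((∑ y ∈ T, (S y).ncard : ℕ) : ℝ) := by
        exact_mod_cast h
    _ = ∑ y ∈ T, ((S y).ncard : ℝ) := by push_cast; rfl
    _ ≤ ∑ _y ∈ T, K := Finset.sum_le_sum fun y hy => (hS y hy).2
    _ = (T : Set α).ncard * K := by simp [Set.ncard_coe_finset]

open Classical in
/-- Let `g` preserve `U` and be semiconjugate to `φ`, with at most `D` relevant preimages of each
point, and at most `D / d` over the complement of `Z`. If `φ`-orbits visit that complement within
`N` steps, then the backward trees of `g` in `U` grow at rate at most `D / d ^ (1 / N)`. -/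
theorem ncard_iterate_fiber_le {P Q : Type*} {g : P → P} {U : Set P} {π : P → Q} {φ : Q → Q}
    {Z : Set Q} {C D D' d n₀ : ℕ} {β : ℝ} (hβ0 : 0 < β) (hβ1 : β ≤ 1) (hβ : d * β ^ (n₀ + 1) = 1)
    (hDD : D = D' * d)
    (hπ : ∀ p ∈ U, π (g p) = φ (π p)) (hinv : ∀ p ∈ U, g p ∈ U)
    (h1 : ∀ x ∈ U, {y | y ∈ U ∧ g y = x}.encard ≤ C)
    (h2 : ∀ x ∈ U, {y | y ∈ U ∧ y ∈ g '' U ∧ g y = x}.encard ≤ D)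
    (h3 : ∀ x ∈ U, π x ∉ Z → {y | y ∈ U ∧ y ∈ g '' U ∧ g y = x}.encard ≤ D')
    (horb : ∀ q, ∃ i, i ≤ n₀ ∧ φ^[i] q ∉ Z) (m : ℕ) :
    ∀ x ∈ U, {p | p ∈ U ∧ g^[m + 1] p = x}.Finite ∧
      ({p | p ∈ U ∧ g^[m + 1] p = x}.ncard : ℝ) ≤ C * d * (D * β) ^ m := by
  have hex : ∀ q, ∃ i, φ^[i] q ∉ Z := fun q => (horb q).imp fun _ h => h.2
  have hle : ∀ q, Nat.find (hex q) ≤ n₀ := fun q => by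
    obtain ⟨i, hi, hiZ⟩ := horb q
    exact (Nat.find_min' (hex q) hiZ).trans hi
  have hd0 : (0 : ℝ) ≤ d := Nat.cast_nonneg d
  -- The induction carries a weight: the exponent of the last factor is the time that the orbit of
  -- `φ (π x)` needs to leave `Z`. A step in `Z` pays for its missing gain by shortening this
  -- waiting time.
  suffices H : ∀ x ∈ U, {p | p ∈ U ∧ g^[m + 1] p = x}.Finite ∧
      ({p | p ∈ U ∧ g^[m + 1] p = x}.ncard : ℝ) ≤
        C * d * (D * β) ^ m * β ^ Nat.find (hex (φ (π x))) by
    intro x hx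
    refine ⟨(H x hx).1, (H x hx).2.trans ?_⟩
    exact mul_le_of_le_one_right (by positivity) (pow_le_one₀ hβ0.le hβ1)
  induction m with
  | zero =>
    intro x hx
    have hf : {p | p ∈ U ∧ g p = x}.Finite := Set.finite_of_encard_le_coe (h1 x hx)
    refine ⟨hf, ?_⟩
    have hc : {p | p ∈ U ∧ g p = x}.ncard ≤ C := by
      have := h1 x hx
      rw [← hf.cast_ncard_eq] at this
      exact_mod_cast this
    -- The factor `d = β ^ (-(n₀ + 1))` in the constant absorbs the weight at the start of the
    -- induction.
    have h4 : β ^ (n₀ + 1) ≤ β ^ Nat.find (hex (φ (π x))) :=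
      pow_le_pow_of_le_one hβ0.le hβ1 ((hle _).trans (Nat.le_succ _))
    calc ({p | p ∈ U ∧ g^[0 + 1] p = x}.ncard : ℝ) ≤ C := by exact_mod_cast hc
      _ = C * d * (D * β) ^ 0 * β ^ (n₀ + 1) := by linear_combination -C * hβ
      _ ≤ _ := by gcongr
  | succ m ih =>
    intro x hx
    have hT := h2 x hx
    have hT' := h3 x hx
    set T := {y | y ∈ U ∧ y ∈ g '' U ∧ g y = x} with hTdef
    have hTf : T.Finite := Set.finite_of_encard_le_coe hT
    have hcard : ∀ n : ℕ, T.encard ≤ n → (T.ncard : ℝ) ≤ n := fun n hn => by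
      rw [← hTf.cast_ncard_eq] at hn
      exact_mod_cast hn
    have hU : ∀ (n : ℕ), ∀ p ∈ U, g^[n] p ∈ U := fun n p hp => by
      induction n with
      | zero => exact hp
      | succ n ihn => rw [Function.iterate_succ_apply']; exact hinv _ ihn
    -- Only the farthest generation of the backward tree can miss `g '' U`; that generation costs
    -- `C` once, and every other one obeys the sharper bounds `D` and `D'`.
    have hunion : {p | p ∈ U ∧ g^[m + 1 + 1] p = x} = ⋃ y ∈ T, {p | p ∈ U ∧ g^[m + 1] p = y} := by
      ext p
      simp only [Set.mem_iUnion, Set.mem_ofPred_eq, exists_prop, hTdef]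
      constructor
      · rintro ⟨hp, hx⟩
        refine ⟨g^[m + 1] p, ⟨hU _ p hp, ⟨g^[m] p, hU _ p hp, ?_⟩, ?_⟩, hp, rfl⟩
        · rw [Function.iterate_succ_apply']
        · exact (Function.iterate_succ_apply' g (m + 1) p).symm.trans hx
      · rintro ⟨y, ⟨-, -, hy⟩, hp, rfl⟩
        exact ⟨hp, by rw [Function.iterate_succ_apply', hy]⟩
    have hstep := hTf.ncard_biUnion_le_mul (S := fun y => {p | p ∈ U ∧ g^[m + 1] p = y})
      (K := C * d * (D * β) ^ m * β ^ Nat.find (hex (π x))) (fun y hy => by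
        have := ih y hy.1
        rwa [← hπ y hy.1, hy.2.2] at this)
    rw [hunion]
    refine ⟨hstep.1, hstep.2.trans ?_⟩
    -- In `Z` the waiting time from `π x` is one more than from `φ (π x)`, which supplies the factor
    -- `β`. Outside `Z` it is `0`, and `D' = D β ^ (n₀ + 1)` supplies `β` together with the full
    -- weight `β ^ n₀`.
    by_cases hxZ : π x ∈ Z
    · have hfind : Nat.find (hex (π x)) = Nat.find (hex (φ (π x))) + 1 := by
        exact Nat.find_comp_succ (hex (π x)) (hex (φ (π x))) (by simpa using hxZ)
      rw [hfind]
      calc (T.ncard : ℝ) * (C * d * (D * β) ^ m * β ^ (Nat.find (hex (φ (π x))) + 1))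
          ≤ D * (C * d * (D * β) ^ m * β ^ (Nat.find (hex (φ (π x))) + 1)) := by
            gcongr
            exact_mod_cast hcard D hT
        _ = _ := by ring
    · calc (T.ncard : ℝ) * (C * d * (D * β) ^ m * β ^ Nat.find (hex (π x)))
          ≤ D' * (C * d * (D * β) ^ m * 1) := by
            gcongr
            · exact_mod_cast hcard D' (hT' hxZ)
            · exact pow_le_one₀ hβ0.le hβ1
        _ = C * d * (D * β) ^ (m + 1) * β ^ n₀ := by
            rw [hDD]
            push_cast
            linear_combination (-(D' * (C * d * (D' * d * β) ^ m))) * hβ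
        _ ≤ _ := by
            exact mul_le_mul_of_nonneg_left
              (pow_le_pow_of_le_one hβ0.le hβ1 (hle _)) (by positivity)

theorem limsup_rpow_le_of_le_mul_pow {u : ℕ → ℝ≥0∞} {K lam : ℝ} (hK : 0 < K) (hlam : 0 < lam)
    (hu : ∀ m, u (m + 1) ≤ ENNReal.ofReal (K * lam ^ (m + 1))) :
    Filter.limsup (fun n : ℕ => u n ^ (1 / (n : ℝ))) Filter.atTop ≤ ENNReal.ofReal lam := by
  have hlim : Filter.Tendsto (fun n : ℕ => ENNReal.ofReal (K ^ (1 / (n : ℝ)) * lam)) Filter.atTop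
      (𝓝 (ENNReal.ofReal lam)) := by
    refine ENNReal.tendsto_ofReal ?_
    have h1 : Filter.Tendsto (fun n : ℕ => K ^ (1 / (n : ℝ))) Filter.atTop (𝓝 (K ^ (0 : ℝ))) :=
      (Real.continuousAt_const_rpow hK.ne').tendsto.comp (tendsto_const_div_atTop_nhds_zero_nat 1)
    simpa using h1.mul_const lam
  rw [← hlim.limsup_eq]
  refine Filter.limsup_le_limsup ?_
  filter_upwards [Filter.eventually_ge_atTop 1] with n hn
  obtain ⟨m, rfl⟩ : ∃ m, n = m + 1 := ⟨n - 1, by omega⟩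
  have hn0 : (0 : ℝ) < ((m + 1 : ℕ) : ℝ) := by positivity
  calc u (m + 1) ^ (1 / ((m + 1 : ℕ) : ℝ))
      ≤ ENNReal.ofReal (K * lam ^ (m + 1)) ^ (1 / ((m + 1 : ℕ) : ℝ)) :=
        ENNReal.rpow_le_rpow (hu m) (by positivity)
    _ = ENNReal.ofReal (K ^ (1 / ((m + 1 : ℕ) : ℝ)) * lam) := by
        rw [ENNReal.ofReal_rpow_of_pos (by positivity), Real.mul_rpow hK.le (by positivity),
          ← Real.rpow_natCast, ← Real.rpow_mul hlam.le, mul_one_div_cancel hn0.ne', Real.rpow_one]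

/-- This removes multiplicities: `U` itself is one of the neighbourhoods in the infimum, so a bound
on plain fibre cardinalities in `U`, uniform over all values, suffices. -/
theorem countMult_inter_le {α β : Type*} [TopologicalSpace α] (g : α → β) {U : Set α}
    (hU : IsOpen U) (x : β) :
    countMult g (g ⁻¹' {x} ∩ U) ≤ ⨆ y, (g ⁻¹' {y} ∩ U).encard :=
  iInf₂_le U (hU.mem_nhdsSet.2 Set.inter_subset_right)

theorem exists_pow_mul_eq_one {d : ℕ} (hd : 2 ≤ d) (n : ℕ) :
    ∃ β : ℝ, 0 < β ∧ β < 1 ∧ d * β ^ (n + 1) = 1 := by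
  have hd0 : (0 : ℝ) < d := by positivity
  have hd1 : (1 : ℝ) < d := by exact_mod_cast hd
  refine ⟨(d : ℝ)⁻¹ ^ (((n + 1 : ℕ) : ℝ)⁻¹), by positivity, ?_, ?_⟩
  · exact Real.rpow_lt_one (by positivity) (inv_lt_one_of_one_lt₀ hd1) (by positivity)
  · rw [Real.rpow_inv_natCast_pow (by positivity) (by omega), mul_inv_cancel₀ hd0.ne']

/-- The growth of backward orbits controls the small topological degree condition. -/
theorem limsup_countMult_lt {P Q : Type*} [TopologicalSpace P] {g : P → P} {U W : Set P}
    {π : P → Q} {φ : Q → Q} {Z : Set Q} {C d s n₀ : ℕ} (hd : 2 ≤ d) (hs : 1 ≤ s) (hW : IsOpen W)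
    (hWU : W ⊆ U) (hπ : ∀ p ∈ U, π (g p) = φ (π p)) (hinv : ∀ p ∈ U, g p ∈ U)
    (h1 : ∀ x ∈ U, {y | y ∈ U ∧ g y = x}.encard ≤ C)
    (h2 : ∀ x ∈ U, {y | y ∈ U ∧ y ∈ g '' U ∧ g y = x}.encard ≤ (d ^ s : ℕ))
    (h3 : ∀ x ∈ U, π x ∉ Z → {y | y ∈ U ∧ y ∈ g '' U ∧ g y = x}.encard ≤ (d ^ (s - 1) : ℕ))
    (horb : ∀ q, ∃ i, i ≤ n₀ ∧ φ^[i] q ∉ Z) (x : P) :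
    Filter.limsup
      (fun n : ℕ => ((countMult g^[n] (g^[n] ⁻¹' {x} ∩ W) : ℕ∞) : ℝ≥0∞) ^ (1 / (n : ℝ)))
      Filter.atTop < (d : ℝ≥0∞) ^ s := by
  obtain ⟨β, hβ0, hβ1, hβ⟩ := exists_pow_mul_eq_one hd n₀
  have hd0 : (0 : ℝ) < d := by positivity
  have hlam : 0 < ((d ^ s : ℕ) : ℝ) * β := by positivity
  have hlt : ((d ^ s : ℕ) : ℝ) * β < ((d ^ s : ℕ) : ℝ) :=
    mul_lt_of_lt_one_right (by positivity) hβ1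
  have hU : ∀ (n : ℕ), ∀ p ∈ U, g^[n] p ∈ U := fun n p hp => by
    induction n with
    | zero => exact hp
    | succ n ihn => rw [Function.iterate_succ_apply']; exact hinv _ ihn
  have hcount := ncard_iterate_fiber_le (C := C) hβ0 hβ1.le hβ
    (show d ^ s = d ^ (s - 1) * d by rw [← pow_succ, Nat.sub_add_cancel hs]) hπ hinv h1 h2 h3 horb
  -- The division compensates for the exponent `m` in place of `m + 1`; the `+ 1` keeps the constant
  -- positive even for `C = 0`.
  refine lt_of_le_of_lt (limsup_rpow_le_of_le_mul_pow
    (K := (C * d + 1) / (((d ^ s : ℕ) : ℝ) * β)) (by positivity) hlam fun m => ?_) ?_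
  · set B : ℝ := C * d * (((d ^ s : ℕ) : ℝ) * β) ^ m with hB
    have hB0 : 0 ≤ B := by positivity
    have hbound : countMult g^[m + 1] (g^[m + 1] ⁻¹' {x} ∩ W) ≤ (⌊B⌋₊ : ℕ) := by
      refine (countMult_inter_le _ hW x).trans (iSup_le fun y => ?_)
      by_cases hy : y ∈ U
      · obtain ⟨hf, hc⟩ := hcount m y hy
        refine le_trans (Set.encard_le_encard (t := {p | p ∈ U ∧ g^[m + 1] p = y}) ?_) ?_
        · rintro p ⟨hp, hpW⟩
          exact ⟨hWU hpW, hp⟩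
        · rw [← hf.cast_ncard_eq]
          exact Nat.cast_le.2 (Nat.le_floor hc)
      · have : g^[m + 1] ⁻¹' {y} ∩ W = ∅ := by
          refine Set.eq_empty_of_forall_notMem ?_
          rintro p ⟨hp, hpW⟩
          exact hy (hp ▸ hU _ p (hWU hpW))
        rw [this, Set.encard_empty]
        exact zero_le
    calc ((countMult g^[m + 1] (g^[m + 1] ⁻¹' {x} ∩ W) : ℕ∞) : ℝ≥0∞)
        ≤ (((⌊B⌋₊ : ℕ) : ℕ∞) : ℝ≥0∞) := by exact_mod_cast hbound
      _ = ENNReal.ofReal (⌊B⌋₊ : ℕ) := by simp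
      _ ≤ ENNReal.ofReal ((C * d + 1) / (((d ^ s : ℕ) : ℝ) * β) *
            (((d ^ s : ℕ) : ℝ) * β) ^ (m + 1)) := by
          refine ENNReal.ofReal_le_ofReal ((Nat.floor_le hB0).trans ?_)
          rw [pow_succ', ← mul_assoc, div_mul_cancel₀ _ hlam.ne', hB]
          gcongr
          linarith
  · calc ENNReal.ofReal (((d ^ s : ℕ) : ℝ) * β) < ENNReal.ofReal ((d ^ s : ℕ) : ℝ) :=
          (ENNReal.ofReal_lt_ofReal_iff (by positivity)).2 hlt
      _ = (d : ℝ≥0∞) ^ s := by rw [ENNReal.ofReal_natCast]; push_cast; rfl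

/-! ### Neighbourhoods of the exceptional sets -/

/-- If `φ^[i] q` avoids the closed set `Z`, some neighbourhood of `Z` is avoided by `φ^[i]` of all
points near `q`. Compactness leaves finitely many neighbourhoods to intersect, with the same bound
`n`. -/
theorem exists_isOpen_forall_exists_notMem {Q : Type*} [TopologicalSpace Q] [CompactSpace Q]
    [T2Space Q] {φ : Q → Q} (hφ : Continuous φ) {Z : Set Q} (hZ : IsClosed Z) {n : ℕ}
    (h : ∀ q, ∃ i, i ≤ n ∧ φ^[i] q ∉ Z) :
    ∃ V, IsOpen V ∧ Z ⊆ V ∧ ∀ q, ∃ i, i ≤ n ∧ φ^[i] q ∉ V := by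
  have key : ∃ V, IsOpen V ∧ Z ⊆ V ∧ ∀ q ∈ (Set.univ : Set Q), ∃ i, i ≤ n ∧ φ^[i] q ∉ V := by
    refine isCompact_univ.induction_on
      (p := fun S => ∃ V, IsOpen V ∧ Z ⊆ V ∧ ∀ q ∈ S, ∃ i, i ≤ n ∧ φ^[i] q ∉ V) ?_ ?_ ?_ ?_
    · exact ⟨Set.univ, isOpen_univ, Set.subset_univ _, fun q hq => hq.elim⟩
    · rintro S T hST ⟨V, hV, hZV, H⟩
      exact ⟨V, hV, hZV, fun q hq => H q (hST hq)⟩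
    · rintro S T ⟨V, hV, hZV, H⟩ ⟨V', hV', hZV', H'⟩
      refine ⟨V ∩ V', hV.inter hV', Set.subset_inter hZV hZV', fun q hq => ?_⟩
      rcases hq with hq | hq
      · exact (H q hq).imp fun i hi => ⟨hi.1, fun hm => hi.2 hm.1⟩
      · exact (H' q hq).imp fun i hi => ⟨hi.1, fun hm => hi.2 hm.2⟩
    · intro q _
      obtain ⟨i, hi, hqi⟩ := h q
      obtain ⟨V, O, hV, hO, hZV, hqO, hVO⟩ := normal_separation hZ
        (isClosed_singleton (x := φ^[i] q)) (Set.disjoint_singleton_right.2 hqi)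
      refine ⟨φ^[i] ⁻¹' O, mem_nhdsWithin_of_mem_nhds
        ((hO.preimage (hφ.iterate i)).mem_nhds (hqO rfl)), V, hV, hZV, fun q' hq' => ?_⟩
      exact ⟨i, hi, fun hm => Set.disjoint_left.1 hVO hm hq'⟩
  obtain ⟨V, hV, hZV, H⟩ := key
  exact ⟨V, hV, hZV, fun q => H q trivial⟩

/-- The pairs on which the power map `t ↦ t ^ d` does not identify distinct points. -/
def powSeparated (d : ℕ) : Set (ℂ × ℂ) := {p | p.1 ^ d = p.2 ^ d → p.1 = p.2}

theorem mem_interior_powSeparated_of_pow_ne {d : ℕ} {a b : ℂ} (h : a ^ d ≠ b ^ d) :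
    (a, b) ∈ interior (powSeparated d) := by
  refine mem_interior.2 ⟨{p | p.1 ^ d ≠ p.2 ^ d}, fun p hp h => (hp h).elim,
    isOpen_ne_fun (by fun_prop) (by fun_prop), h⟩

/-- In `x ^ d - y ^ d = (x - y) ∑ x ^ i y ^ (d - 1 - i)` the second factor equals `d a ^ (d - 1) ≠
0` at `(a, a)`, hence is nonzero nearby. -/
theorem mem_interior_powSeparated_of_ne_zero {d : ℕ} (hd : d ≠ 0) {a : ℂ} (ha : a ≠ 0) :
    (a, a) ∈ interior (powSeparated d) := by
  refine mem_interior.2 ⟨{p | ∑ i ∈ Finset.range d, p.1 ^ i * p.2 ^ (d - 1 - i) ≠ 0},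
    fun p hp h => ?_, isOpen_ne_fun (by fun_prop) (by fun_prop), ?_⟩
  · have h1 := (Commute.all p.1 p.2).geom_sum₂_mul d
    rw [h, sub_self] at h1
    exact sub_eq_zero.1 ((mul_eq_zero.1 h1).resolve_left hp)
  · have h2 : ∀ i ∈ Finset.range d, a ^ i * a ^ (d - 1 - i) = a ^ (d - 1) := fun i hi => by
      have := Finset.mem_range.1 hi
      rw [← pow_add]
      congr 1
      omega
    change ∑ i ∈ Finset.range d, a ^ i * a ^ (d - 1 - i) ≠ 0
    rw [Finset.sum_congr rfl h2, Finset.sum_const, Finset.card_range, nsmul_eq_mul]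
    exact mul_ne_zero (Nat.cast_ne_zero.2 hd) (pow_ne_zero _ ha)

/-! ### Uniform versions, by compactness, of the two savings off `X` and `Y`. -/

namespace PencilPair

variable {k d : ℕ} (f : PencilPair k d)

/-- Semicontinuity: the infimum in `countMult` is attained up to strict inequality by a
neighbourhood `W` of the fibre of `f_∞⁺`. As `f_∞⁺` is a closed map, `W` contains the full preimage
of a neighbourhood of the value. -/
theorem exists_isOpen_encard_le {z : CP k} (hz : z ∉ f.XMinusOne) :
    ∃ V, IsOpen V ∧ f.fPlus z ∈ V ∧
      ∀ y, (f.fInf ⁻¹' {y} ∩ f.fPlus ⁻¹' V).encard ≤ (d ^ (k - 2) : ℕ) := by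
  have hlt : countMult f.fInf (f.fPlus ⁻¹' {f.fPlus z}) < ((d ^ (k - 2) + 1 : ℕ) : ℕ∞) :=
    not_le.1 hz
  obtain ⟨W, hW⟩ := iInf_lt_iff.1 hlt
  obtain ⟨hWn, hW⟩ := iInf_lt_iff.1 hW
  have hsub := subset_interior_iff_mem_nhdsSet.2 hWn
  have hcl : IsClosedMap f.fPlus := f.continuous_fPlus.isClosedMap
  refine ⟨(f.fPlus '' (interior W)ᶜ)ᶜ, (hcl _ isOpen_interior.isClosed_compl).isOpen_compl,
    ?_, fun y => ?_⟩
  · rintro ⟨w, hw, hwz⟩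
    exact hw (hsub hwz)
  · have h1 : f.fInf ⁻¹' {y} ∩ f.fPlus ⁻¹' (f.fPlus '' (interior W)ᶜ)ᶜ ⊆ f.fInf ⁻¹' {y} ∩ W := by
      rintro w ⟨hw, hwV⟩
      refine ⟨hw, ?_⟩
      by_contra hwW
      exact hwV ⟨w, fun h => hwW (interior_subset h), rfl⟩
    have h2 := lt_of_le_of_lt
      ((Set.encard_le_encard h1).trans (le_iSup (fun y => (f.fInf ⁻¹' {y} ∩ W).encard) y)) hW
    push_cast at h2 ⊢
    exact Order.le_of_lt_add_one h2

theorem isClosed_XMinusOne : IsClosed f.XMinusOne := by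
  rw [← isOpen_compl_iff, isOpen_iff_mem_nhds]
  intro z hz
  obtain ⟨V, hV, hzV, hb⟩ := f.exists_isOpen_encard_le hz
  filter_upwards [(hV.preimage f.continuous_fPlus).mem_nhds hzV] with w hw
  have hmem : f.fPlus ⁻¹' V ∈ 𝓝ˢ (f.fPlus ⁻¹' {f.fPlus w}) := by
    refine (hV.preimage f.continuous_fPlus).mem_nhdsSet.2 ?_
    intro w' hw'
    rw [Set.mem_preimage, Set.mem_singleton_iff] at hw'
    rw [Set.mem_preimage, hw']
    exact hw
  intro hX
  have hX' : ((d ^ (k - 2) + 1 : ℕ) : ℕ∞) ≤ countMult f.fInf (f.fPlus ⁻¹' {f.fPlus w}) := hX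
  have h1 := hX'.trans ((iInf₂_le _ hmem).trans (iSup_le hb))
  have h2 : d ^ (k - 2) + 1 ≤ d ^ (k - 2) := by exact_mod_cast h1
  omega

theorem isClosed_X : IsClosed f.X :=
  (f.isClosed_XMinusOne.isCompact.image f.continuous_fInf).isClosed

/-- The vectors whose image under the lift of `f_∞` has norm `1`. -/
def unitLift : Set (Fin k → ℂ) := {z | ‖f.lift z‖ = 1}

theorem isCompact_unitLift : IsCompact f.unitLift := by
  obtain ⟨m, M, hm, -, h⟩ := f.exists_bounds
  refine Metric.isCompact_of_isClosed_isBounded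
    (isClosed_eq f.continuous_lift.norm continuous_const) ?_
  rw [isBounded_iff_forall_norm_le]
  refine ⟨max 1 m⁻¹, fun z hz => ?_⟩
  by_contra! hlt
  have h1 : 1 < ‖z‖ := (le_max_left _ _).trans_lt hlt
  have h2 : m⁻¹ < ‖z‖ := (le_max_right _ _).trans_lt hlt
  have h3 : ‖z‖ ≤ ‖z‖ ^ d := le_self_pow₀ h1.le f.degree_ne_zero
  have h4 := (h z).1
  rw [show ‖f.lift z‖ = 1 from hz] at h4
  have h5 : m * m⁻¹ < m * ‖z‖ := mul_lt_mul_of_pos_left h2 hm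
  rw [mul_inv_cancel₀ hm.ne'] at h5
  have h6 : m * ‖z‖ ≤ m * ‖z‖ ^ d := mul_le_mul_of_nonneg_left h3 hm.le
  linarith

instance : CompactSpace f.unitLift := isCompact_iff_compactSpace.1 f.isCompact_unitLift

theorem ne_zero_of_unitLift (s : f.unitLift) : (s : Fin k → ℂ) ≠ 0 := by
  refine f.ne_zero_of_lift_ne_zero fun h => ?_
  have : ‖f.lift s‖ = 1 := s.2
  simp [h] at this

/-- The projection from `unitLift` to projective space. -/
def toCP (s : f.unitLift) : CP k := Projectivization.mk ℂ s.1 (f.ne_zero_of_unitLift s)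

theorem continuous_toCP : Continuous f.toCP :=
  CP.continuous_mk continuous_subtype_val f.ne_zero_of_unitLift

theorem fInf_toCP_eq {s t : f.unitLift} (h : f.lift s = f.lift t) :
    f.fInf (f.toCP s) = f.fInf (f.toCP t) := by
  rw [toCP, toCP, fInf_mk_eq, fInf_mk_eq, Projectivization.mk_eq_mk_iff']
  exact ⟨1, by rw [one_smul, h]⟩

theorem fPlus_toCP_eq_iff {s t : f.unitLift} (h : f.lift s = f.lift t) :
    f.fPlus (f.toCP s) = f.fPlus (f.toCP t) ↔ f.res s = f.res t := by
  rw [toCP, toCP, fPlus_mk_eq, fPlus_mk_eq, Projectivization.mk_eq_mk_iff']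
  constructor
  · rintro ⟨a, ha⟩
    obtain ⟨h1, h2⟩ := snoc_eq_smul_snoc_iff.1 ha
    have h3 : a • f.lift t = (1 : ℂ) • f.lift t := by rw [h1, h, one_smul]
    rw [smul_left_injective ℂ (f.lift_ne_zero (f.ne_zero_of_unitLift t)) h3, one_mul] at h2
    exact h2.symm
  · intro hR
    exact ⟨1, by rw [one_smul, h, hR]⟩

/-- Among unit lifts with the same `F`, a fibre of `f_∞⁺` is a level of `R`. Off `X` the bound on
exact levels extends to `η`-close values of `R`, with `η` uniform by compactness. -/
theorem exists_encard_near_le {O : Set (CP k)} (hO : IsOpen O) (hXO : f.X ⊆ O) :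
    ∃ η > 0, ∀ s : f.unitLift, f.fInf (f.toCP s) ∉ O →
      (f.toCP '' {t | f.lift t = f.lift s ∧ ‖f.res t - f.res s‖ < η}).encard ≤
        (d ^ (k - 2) : ℕ) := by
  have hK : IsCompact {s : f.unitLift | f.fInf (f.toCP s) ∉ O} :=
    (hO.isClosed_compl.preimage (f.continuous_fInf.comp f.continuous_toCP)).isCompact
  refine hK.induction_on (p := fun K => ∃ η > 0, ∀ s ∈ K,
    (f.toCP '' {t | f.lift t = f.lift s ∧ ‖f.res t - f.res s‖ < η}).encard ≤
      (d ^ (k - 2) : ℕ)) ?_ ?_ ?_ ?_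
  · exact ⟨1, one_pos, fun s hs => hs.elim⟩
  · rintro K K' hKK ⟨η, hη, H⟩
    exact ⟨η, hη, fun s hs => H s (hKK hs)⟩
  · rintro K K' ⟨η, hη, H⟩ ⟨η', hη', H'⟩
    refine ⟨min η η', lt_min hη hη', fun s hs => ?_⟩
    rcases hs with hs | hs
    · refine le_trans (Set.encard_le_encard (Set.image_mono ?_)) (H s hs)
      exact fun t ht => ⟨ht.1, ht.2.trans_le (min_le_left _ _)⟩
    · refine le_trans (Set.encard_le_encard (Set.image_mono ?_)) (H' s hs)
      exact fun t ht => ⟨ht.1, ht.2.trans_le (min_le_right _ _)⟩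
  · intro s₀ hs₀
    have hs₀X : f.toCP s₀ ∉ f.XMinusOne := fun h => hs₀ (hXO ⟨_, h, rfl⟩)
    obtain ⟨V, hV, hsV, hb⟩ := f.exists_isOpen_encard_le hs₀X
    have hcl : Continuous fun t : f.unitLift => f.lift t :=
      f.continuous_lift.comp continuous_subtype_val
    have hcr : Continuous fun t : f.unitLift => f.res t :=
      f.continuous_res.comp continuous_subtype_val
    have hcont : Continuous fun t : f.unitLift =>
        ‖f.lift t - f.lift s₀‖ + ‖f.res t - f.res s₀‖ :=
      (hcl.sub continuous_const).norm.add (hcr.sub continuous_const).norm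
    have hT : IsCompact {t : f.unitLift | f.fPlus (f.toCP t) ∉ V} :=
      (hV.isClosed_compl.preimage (f.continuous_fPlus.comp f.continuous_toCP)).isCompact
    -- Unit lifts sent outside `V` by `f_∞⁺` form a compact set on which `(F, R)` stays at positive
    -- distance from its value at `s₀`. Half of this distance is spent on moving `s₀` to `s`, half
    -- on moving `s` to `t`.
    obtain ⟨η, hη, hmin⟩ := hT.exists_forall_le' (a := 0) hcont.continuousOn (by
      intro t ht
      by_contra! hle
      have h1 := norm_nonneg (f.lift t - f.lift s₀)
      have h2 := norm_nonneg (f.res t - f.res s₀)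
      have h3 : f.lift t = f.lift s₀ := sub_eq_zero.1 (norm_eq_zero.1 (by linarith))
      have h4 : f.res t = f.res s₀ := sub_eq_zero.1 (norm_eq_zero.1 (by linarith))
      exact ht (by rw [(f.fPlus_toCP_eq_iff h3).2 h4]; exact hsV))
    refine ⟨{t | ‖f.lift t - f.lift s₀‖ + ‖f.res t - f.res s₀‖ < η / 2},
      mem_nhdsWithin_of_mem_nhds ((isOpen_lt hcont continuous_const).mem_nhds ?_), η / 2,
      half_pos hη, fun s hs => ?_⟩
    · rw [Set.mem_ofPred_eq, sub_self, sub_self, norm_zero, norm_zero, add_zero]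
      exact half_pos hη
    · rw [Set.mem_ofPred_eq] at hs
      refine le_trans (Set.encard_le_encard ?_) (hb (f.fInf (f.toCP s)))
      rintro _ ⟨t, ⟨hts, htr⟩, rfl⟩
      refine ⟨f.fInf_toCP_eq hts, ?_⟩
      by_contra htV
      have h1 := hmin t htV
      rw [hts] at h1
      have h2 : ‖f.res t - f.res s₀‖ ≤ ‖f.res t - f.res s‖ + ‖f.res s - f.res s₀‖ :=
        norm_sub_le_norm_sub_add_norm_sub _ _ _
      linarith

/-- A closed part of `Y` outside of which the power map separates residues, uniformly. -/
def closedY : Set (CP k) :=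
  (fun p : f.unitLift × f.unitLift => f.fInf^[2] (f.toCP p.1)) ''
    {p | f.lift p.1 = f.lift p.2 ∧ (f.res p.1, f.res p.2) ∉ interior (powSeparated d)}

theorem isClosed_closedY : IsClosed f.closedY := by
  refine (IsCompact.image (IsClosed.isCompact ?_) ?_).isClosed
  · refine IsClosed.inter (isClosed_eq (f.continuous_lift.comp (by fun_prop))
      (f.continuous_lift.comp (by fun_prop))) ?_
    exact isOpen_interior.isClosed_compl.preimage
      ((f.continuous_res.comp (by fun_prop)).prodMk (f.continuous_res.comp (by fun_prop)))
  · exact (f.continuous_fInf.iterate 2).comp (f.continuous_toCP.comp continuous_fst)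

/-- A pair of residues outside the interior of `powSeparated d` has equal `d`-th powers. Either the
residues coincide, and then they vanish, or they differ, and then the two points have distinct
images under `f_∞⁺` that `f_1` identifies. These are the two parts of `YMinusTwo`. -/
theorem closedY_subset : f.closedY ⊆ f.Y := by
  rintro _ ⟨⟨s, t⟩, ⟨hl, hR⟩, rfl⟩
  refine ⟨f.toCP s, ?_, rfl⟩
  by_contra hY
  rw [YMinusTwo, Set.mem_union, not_or, Set.mem_ofPred_eq, Set.mem_ofPred_eq] at hY
  obtain ⟨hY1, hY2⟩ := hY
  simp only at hl hR
  have hs : f.res s ≠ 0 := by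
    obtain ⟨a, ha⟩ := Projectivization.exists_smul_eq_mk_rep ℂ s.1 (f.ne_zero_of_unitLift s)
    intro h0
    apply hY1
    rw [toCP, ← ha]
    change f.res ((a : ℂ) • s.1) = 0
    rw [res_smul, h0, mul_zero]
  by_cases hp : f.fPlus (f.toCP s) = f.fPlus (f.toCP t)
  · rw [f.fPlus_toCP_eq_iff hl] at hp
    rw [← hp] at hR
    exact hR (mem_interior_powSeparated_of_ne_zero f.degree_ne_zero hs)
  · refine hY2 ⟨f.toCP t, hp, f.fInf_toCP_eq hl, ?_⟩
    have hpow : f.res s ^ d = f.res t ^ d := by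
      by_contra hne
      exact hR (mem_interior_powSeparated_of_pow_ne hne)
    rw [toCP, toCP, fPlus_mk_eq, fPlus_mk_eq,
      fEps_mk_eq f 1 _ (f.lift_ne_zero (f.ne_zero_of_unitLift s)),
      fEps_mk_eq f 1 _ (f.lift_ne_zero (f.ne_zero_of_unitLift t)),
      Projectivization.mk_eq_mk_iff']
    exact ⟨1, by rw [one_smul, hl, hpow]⟩

/-- The relevant residue pairs form a compact subset of the interior of `powSeparated d`, so a whole
`η`-thickening of it stays inside. -/
theorem exists_eq_of_pow_eq_near {O : Set (CP k)} (hO : IsOpen O) (hYO : f.closedY ⊆ O) :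
    ∃ η > 0, ∀ s t : f.unitLift, f.lift s = f.lift t → f.fInf^[2] (f.toCP s) ∉ O →
      ∀ a b : ℂ, ‖a - f.res s‖ < η → ‖b - f.res t‖ < η → a ^ d = b ^ d → a = b := by
  have hK : IsCompact {p : f.unitLift × f.unitLift |
      f.lift p.1 = f.lift p.2 ∧ f.fInf^[2] (f.toCP p.1) ∉ O} := by
    refine IsClosed.isCompact (IsClosed.inter (isClosed_eq (f.continuous_lift.comp (by fun_prop))
      (f.continuous_lift.comp (by fun_prop))) ?_)
    exact hO.isClosed_compl.preimage
      ((f.continuous_fInf.iterate 2).comp (f.continuous_toCP.comp continuous_fst))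
  have hcont : Continuous fun p : f.unitLift × f.unitLift => (f.res p.1, f.res p.2) :=
    (f.continuous_res.comp (by fun_prop)).prodMk (f.continuous_res.comp (by fun_prop))
  obtain ⟨η, hη, hsub⟩ := (hK.image hcont).exists_thickening_subset_open
    (isOpen_interior (s := powSeparated d)) (by
      rintro _ ⟨p, ⟨hp1, hp2⟩, rfl⟩
      by_contra hne
      exact hp2 (hYO ⟨p, ⟨hp1, hne⟩, rfl⟩))
  refine ⟨η, hη, fun s t hst hsO a b ha hb hab => ?_⟩
  have hmem : (a, b) ∈ powSeparated d := interior_subset (hsub (Metric.mem_thickening_iff.2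
    ⟨(f.res s, f.res t), ⟨(s, t), ⟨hst, hsO⟩, rfl⟩, by
      rw [Prod.dist_eq, max_lt_iff, dist_eq_norm, dist_eq_norm]
      exact ⟨ha, hb⟩⟩))
  exact hmem hab

/-- Disjoint open neighbourhoods of `X` and of `closedY` whose union contains no long orbit. -/
theorem exists_separating_nhds (hXY : Disjoint f.X f.Y)
    (hZ : ∃ n : ℕ, (⋂ i ∈ Set.Iic n, f.fInf^[i] ⁻¹' f.Z) = ∅) :
    ∃ (n : ℕ) (O O' : Set (CP k)), IsOpen O ∧ IsOpen O' ∧ f.X ⊆ O ∧ f.closedY ⊆ O' ∧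
      Disjoint O O' ∧ ∀ q, ∃ i, i ≤ n ∧ f.fInf^[i] q ∉ O ∪ O' := by
  obtain ⟨n, hn⟩ := hZ
  obtain ⟨O, O', hO, hO', hXO, hYO', hdis⟩ := normal_separation f.isClosed_X f.isClosed_closedY
    (hXY.mono_right f.closedY_subset)
  obtain ⟨V, hV, hZV, horb⟩ := exists_isOpen_forall_exists_notMem f.continuous_fInf
    (f.isClosed_X.union f.isClosed_closedY) (n := n) (fun q => by
      by_contra! hcon
      have : q ∈ ⋂ i ∈ Set.Iic n, f.fInf^[i] ⁻¹' f.Z :=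
        Set.mem_iInter₂.2 fun i hi => Set.union_subset_union_right _ f.closedY_subset (hcon i hi)
      rw [hn] at this
      exact this)
  refine ⟨n, O ∩ V, O' ∩ V, hO.inter hV, hO'.inter hV,
    Set.subset_inter hXO (Set.subset_union_left.trans hZV),
    Set.subset_inter hYO' (Set.subset_union_right.trans hZV),
    hdis.mono Set.inter_subset_left Set.inter_subset_left, fun q => ?_⟩
  refine (horb q).imp fun i hi => ⟨hi.1, fun hm => hi.2 ?_⟩
  rcases hm with hm | hm
  exacts [hm.2, hm.2]

end PencilPair

/-! ### Small topological degree -/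

theorem Set.encard_le_mul_of_fiber_le {α β : Type*} (π : α → β) (T : Set α) {a b : ℕ}
    (himg : (π '' T).encard ≤ a) (hfib : ∀ q ∈ π '' T, {y | y ∈ T ∧ π y = q}.encard ≤ b) :
    T.encard ≤ (a * b : ℕ) := by
  classical
  have hif : (π '' T).Finite := Set.finite_of_encard_le_coe himg
  have hTf : T.Finite := by
    refine (hif.biUnion fun q hq => Set.finite_of_encard_le_coe (hfib q hq)).subset fun y hy => ?_
    exact Set.mem_iUnion₂.2 ⟨π y, ⟨y, hy, rfl⟩, hy, rfl⟩
  lift T to Finset α using hTf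
  rw [← Finset.coe_image, Set.encard_coe_eq_coe_finsetCard] at himg
  rw [Set.encard_coe_eq_coe_finsetCard]
  have h1 := Finset.card_le_mul_card_image (f := π) T b (fun q hq => by
    have h2 := hfib q (by rwa [← Finset.coe_image, Finset.mem_coe])
    have h3 : {y | y ∈ (T : Set α) ∧ π y = q} = (T.filter fun y => π y = q : Finset α) := by
      ext y
      simp
    rw [h3, Set.encard_coe_eq_coe_finsetCard] at h2
    exact_mod_cast h2)
  have h4 : (T.image π).card ≤ a := by exact_mod_cast himg
  have h5 : T.card ≤ a * b := h1.trans (by rw [mul_comm]; exact Nat.mul_le_mul_right _ h4)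
  exact_mod_cast h5

/-! ### Fibres of `f_ε` in the tube and the resulting growth bound. -/

namespace PencilPair

variable {k d : ℕ} (f : PencilPair k d)

/-- The point `[z : ε u]`. -/
def pt (ε : ℂ) (z : Fin k → ℂ) (hz : z ≠ 0) (u : ℂ) : CP (k + 1) :=
  Projectivization.mk ℂ (Fin.snoc z (ε * u) : Fin (k + 1) → ℂ) (snoc_ne_zero hz _)

/-- This is the projection from `[0 : ⋯ : 0 : 1]`. At the centre, which lies outside the tube, the
value `[1 : ⋯ : 1]` is arbitrary. -/
theorem exists_base (hk : 1 ≤ k) : ∃ π : CP (k + 1) → CP k, ∀ ε z hz u,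
    π (pt ε z hz u) = Projectivization.mk ℂ z hz := by
  classical
  have h1 : (fun _ : Fin k => (1 : ℂ)) ≠ 0 := fun h => one_ne_zero (congrFun h ⟨0, hk⟩)
  refine ⟨fun p => if h : (fun i : Fin k => p.rep i.castSucc) ≠ 0 then Projectivization.mk ℂ _ h
    else Projectivization.mk ℂ _ h1, fun ε z hz u => ?_⟩
  obtain ⟨a, ha⟩ := Projectivization.exists_smul_eq_mk_rep ℂ
    (Fin.snoc z (ε * u) : Fin (k + 1) → ℂ) (snoc_ne_zero hz _)
  have h2 : (fun i : Fin k => (pt ε z hz u).rep i.castSucc) = (a : ℂ) • z := by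
    funext i
    rw [pt, ← ha]
    change (a : ℂ) * (Fin.snoc z (ε * u) : Fin (k + 1) → ℂ) i.castSucc = (a : ℂ) * z i
    simp
  have h3 : (fun i : Fin k => (pt ε z hz u).rep i.castSucc) ≠ 0 := by
    rw [h2]
    exact smul_ne_zero a.ne_zero hz
  simp only
  rw [dif_pos h3, Projectivization.mk_eq_mk_iff']
  exact ⟨a, h2.symm⟩

theorem pt_eq_pt_iff {ε : ℂ} (hε : ε ≠ 0) {z : Fin k → ℂ} (hz : z ≠ 0) {u u' : ℂ} :
    pt ε z hz u = pt ε z hz u' ↔ u = u' := by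
  rw [pt, pt, Projectivization.mk_eq_mk_iff']
  constructor
  · rintro ⟨t, ht⟩
    obtain ⟨h1, h2⟩ := snoc_eq_smul_snoc_iff.1 ht
    have h3 : t • z = (1 : ℂ) • z := by rw [h1, one_smul]
    rw [smul_left_injective ℂ hz h3, one_mul] at h2
    exact (mul_left_cancel₀ hε h2).symm
  · rintro rfl
    exact ⟨1, one_smul _ _⟩

theorem fEps_pt (ε : ℂ) (z : Fin k → ℂ) (hz : z ≠ 0) (u : ℂ) :
    f.fEps ε (pt ε z hz u) =
      pt ε (f.lift z) (f.lift_ne_zero hz) (f.res z + ε ^ (d - 1) * u ^ d) :=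
  f.fEps_mk_snoc ε z hz u

theorem pt_mem_U_iff {c : ℝ} {ε : ℂ} (hε : ε ≠ 0) (z : Fin k → ℂ) (hz : z ≠ 0) (u : ℂ) :
    pt ε z hz u ∈ f.U c ε ↔ ‖u‖ ≤ c * ‖z‖ :=
  f.mk_snoc_mem_U_iff hε z hz u

section Fibers

variable {f} {c : ℝ} {ε : ℂ} {π : CP (k + 1) → CP k}

theorem exists_pt_of_base_eq (hε : ε ≠ 0)
    (hπ : ∀ ε z hz u, π (pt ε z hz u) = Projectivization.mk ℂ z hz)
    {p : CP (k + 1)} (hp : p ∈ f.U c ε) {v : Fin k → ℂ} (hv : v ≠ 0)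
    (h : π p = Projectivization.mk ℂ v hv) : ∃ u, ‖u‖ ≤ c * ‖v‖ ∧ p = pt ε v hv u := by
  obtain ⟨z, hz, u, hu, rfl⟩ := f.exists_snoc_of_mem_U hε hp
  rw [show Projectivization.mk ℂ _ _ = pt ε z hz u from rfl, hπ,
    Projectivization.mk_eq_mk_iff'] at h
  obtain ⟨t, rfl⟩ := h
  have ht : t ≠ 0 := by
    rintro rfl
    exact hz (zero_smul _ _)
  have hEq : pt ε (t • v) hz u = pt ε v hv (t⁻¹ * u) := by
    rw [pt, pt, Projectivization.mk_eq_mk_iff']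
    refine ⟨t, snoc_eq_smul_snoc_iff.2 ⟨rfl, ?_⟩⟩
    field_simp
  refine ⟨t⁻¹ * u, ?_, hEq⟩
  rw [← f.pt_mem_U_iff hε v hv, ← hEq]
  exact hp

theorem base_fEps (hε : ε ≠ 0)
    (hπ : ∀ ε z hz u, π (pt ε z hz u) = Projectivization.mk ℂ z hz) {p : CP (k + 1)}
    (hp : p ∈ f.U c ε) : π (f.fEps ε p) = f.fInf (π p) := by
  obtain ⟨z, hz, u, hu, rfl⟩ := f.exists_snoc_of_mem_U hε hp
  rw [show Projectivization.mk ℂ _ _ = pt ε z hz u from rfl, fEps_pt, hπ, hπ, fInf_mk_eq]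

theorem pow_eq_pow_of_fEps_pt_eq (hε : ε ≠ 0) {z : Fin k → ℂ} (hz : z ≠ 0) {u u' : ℂ}
    (h : f.fEps ε (pt ε z hz u) = f.fEps ε (pt ε z hz u')) : u ^ d = u' ^ d := by
  rw [fEps_pt, fEps_pt, pt_eq_pt_iff hε] at h
  exact mul_left_cancel₀ (pow_ne_zero _ hε) (add_left_cancel h)

theorem encard_vertical_fiber_le (hε : ε ≠ 0)
    (hπ : ∀ ε z hz u, π (pt ε z hz u) = Projectivization.mk ℂ z hz) (x : CP (k + 1)) (q : CP k) :
    {y | y ∈ {y | y ∈ f.U c ε ∧ f.fEps ε y = x} ∧ π y = q}.encard ≤ d := by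
  classical
  rcases Set.eq_empty_or_nonempty
    {y | y ∈ {y | y ∈ f.U c ε ∧ f.fEps ε y = x} ∧ π y = q} with he | ⟨y₀, ⟨hy₀, hx₀⟩, hq₀⟩
  · rw [he, Set.encard_empty]
    exact zero_le
  induction q using Projectivization.ind with | h z hz => ?_
  obtain ⟨u₀, -, rfl⟩ := exists_pt_of_base_eq hε hπ hy₀ hz hq₀
  have hsub : {y | y ∈ {y | y ∈ f.U c ε ∧ f.fEps ε y = x} ∧ π y = Projectivization.mk ℂ z hz} ⊆
      ((Polynomial.nthRoots d (u₀ ^ d)).toFinset.image fun u => pt ε z hz u :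
        Finset (CP (k + 1))) := by
    rintro y ⟨⟨hy, hx⟩, hq⟩
    obtain ⟨u, -, rfl⟩ := exists_pt_of_base_eq hε hπ hy hz hq
    rw [Finset.mem_coe, Finset.mem_image]
    refine ⟨u, ?_, rfl⟩
    rw [Multiset.mem_toFinset, Polynomial.mem_nthRoots (Nat.pos_of_ne_zero f.degree_ne_zero)]
    exact pow_eq_pow_of_fEps_pt_eq hε hz (hx.trans hx₀.symm)
  refine (Set.encard_le_encard hsub).trans ?_
  rw [Set.encard_coe_eq_coe_finsetCard]
  have h1 := Finset.card_image_le (s := (Polynomial.nthRoots d (u₀ ^ d)).toFinset)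
    (f := fun u => pt ε z hz u)
  exact_mod_cast h1.trans ((Multiset.toFinset_card_le _).trans (Polynomial.card_nthRoots _ _))

theorem image_base_subset (hε : ε ≠ 0)
    (hπ : ∀ ε z hz u, π (pt ε z hz u) = Projectivization.mk ℂ z hz) (x : CP (k + 1)) :
    π '' {y | y ∈ f.U c ε ∧ f.fEps ε y = x} ⊆ f.fInf ⁻¹' {π x} := by
  rintro _ ⟨y, ⟨hy, rfl⟩, rfl⟩
  exact (base_fEps hε hπ hy).symm

/-- The normalisation `‖F w‖ = 1` bounds `‖w‖ ^ d` by `1 / m`, so the distance of the fibre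
coordinate from `R w` is small uniformly in the point. -/
theorem norm_sub_res_le {m : ℝ} (hm : 0 < m) (hc : 0 ≤ c)
    (hmlift : ∀ z, m * ‖z‖ ^ d ≤ ‖f.lift z‖) {w : Fin k → ℂ} (hw : ‖f.lift w‖ = 1) {t : ℂ}
    (ht : ‖t‖ ≤ c * ‖w‖) :
    ‖f.res w + ε ^ (d - 1) * t ^ d - f.res w‖ ≤ ‖ε‖ ^ (d - 1) * (c ^ d / m) := by
  rw [add_sub_cancel_left, norm_mul, norm_pow, norm_pow]
  gcongr
  calc ‖t‖ ^ d ≤ (c * ‖w‖) ^ d := by gcongr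
    _ = c ^ d * ‖w‖ ^ d := mul_pow _ _ _
    _ ≤ c ^ d * (1 / m) := by
        gcongr
        rw [le_div_iff₀ hm, mul_comm, ← hw]
        exact hmlift w
    _ = c ^ d / m := by ring

/-- A point over a unit vector `a` comes from points over `unitLift`. -/
theorem exists_unitLift_of_fEps_eq (hε : ε ≠ 0)
    (hπ : ∀ ε z hz u, π (pt ε z hz u) = Projectivization.mk ℂ z hz)
    {a : Fin k → ℂ} (ha : a ≠ 0) (ha1 : ‖a‖ = 1) {s : ℂ} {y : CP (k + 1)} (hy : y ∈ f.U c ε)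
    (h : f.fEps ε y = pt ε a ha s) :
    ∃ (w : f.unitLift) (t : ℂ), f.lift w = a ∧ ‖t‖ ≤ c * ‖(w : Fin k → ℂ)‖ ∧ π y = f.toCP w ∧
      s = f.res w + ε ^ (d - 1) * t ^ d := by
  have hb := base_fEps hε hπ hy
  rw [h, hπ] at hb
  obtain ⟨w, hw, hwy, hwa⟩ := f.exists_lift_eq (π y) a ha hb.symm
  obtain ⟨t, ht, rfl⟩ := exists_pt_of_base_eq hε hπ hy hw hwy.symm
  refine ⟨⟨w, by rw [unitLift, Set.mem_ofPred_eq, hwa, ha1]⟩, t, hwa, ht, hwy.symm, ?_⟩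
  subst hwa
  rw [fEps_pt, pt_eq_pt_iff hε] at h
  exact h.symm

/-- All preimages of `x` have residues `R` close to the one fibre coordinate `s` of `x`, hence close
to each other. The triangle inequality through `s` is why `η / 2` is required. -/
theorem encard_image_base_le (hε : ε ≠ 0)
    (hπ : ∀ ε z hz u, π (pt ε z hz u) = Projectivization.mk ℂ z hz) {m η : ℝ} (hm : 0 < m)
    (hc : 0 ≤ c) (hmlift : ∀ z, m * ‖z‖ ^ d ≤ ‖f.lift z‖) {O : Set (CP k)}
    (hη : ∀ s : f.unitLift, f.fInf (f.toCP s) ∉ O →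
      (f.toCP '' {t | f.lift t = f.lift s ∧ ‖f.res t - f.res s‖ < η}).encard ≤
        (d ^ (k - 2) : ℕ))
    (hsmall : ‖ε‖ ^ (d - 1) * (c ^ d / m) < η / 2) {x : CP (k + 1)} (hx : x ∈ f.U c ε)
    (hxO : π x ∉ O) :
    (π '' {y | y ∈ f.U c ε ∧ f.fEps ε y = x}).encard ≤ (d ^ (k - 2) : ℕ) := by
  rcases Set.eq_empty_or_nonempty {y | y ∈ f.U c ε ∧ f.fEps ε y = x} with he | ⟨y₀, hy₀, hx₀⟩
  · rw [he, Set.image_empty, Set.encard_empty]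
    exact zero_le
  obtain ⟨a, ha, ha1, hax⟩ := CP.exists_norm_eq_one (π x)
  obtain ⟨s, -, rfl⟩ := exists_pt_of_base_eq hε hπ hx ha hax.symm
  obtain ⟨w₀, t₀, hw₀, ht₀, hyw₀, hs₀⟩ := exists_unitLift_of_fEps_eq hε hπ ha ha1 hy₀ hx₀
  refine le_trans (Set.encard_le_encard ?_) (hη w₀ ?_)
  · rintro _ ⟨y, ⟨hy, hyx⟩, rfl⟩
    obtain ⟨w, t, hw, ht, hyw, hs⟩ := exists_unitLift_of_fEps_eq hε hπ ha ha1 hy hyx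
    refine ⟨w, ⟨hw.trans hw₀.symm, ?_⟩, hyw.symm⟩
    have h1 := norm_sub_res_le (ε := ε) hm hc hmlift w.2 ht
    have h2 := norm_sub_res_le (ε := ε) hm hc hmlift w₀.2 ht₀
    rw [← hs] at h1
    rw [← hs₀] at h2
    have h3 := norm_sub_le_norm_sub_add_norm_sub (f.res w) s (f.res w₀)
    rw [norm_sub_rev (f.res w) s] at h3
    linarith
  · rwa [← hyw₀, ← base_fEps hε hπ hy₀, hx₀]

/-- Two such points over the same base point have fibre coordinates `u`, `u'` with equal `d`-th
powers. Both points being images of points of the tube, `u` and `u'` are close to `R w` and `R w'`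
for unit lifts with `F w = F w'`. As `π x = f_∞² [w]` avoids `O`, closeness forces `u = u'`. -/
theorem injOn_base (hε : ε ≠ 0)
    (hπ : ∀ ε z hz u, π (pt ε z hz u) = Projectivization.mk ℂ z hz) {m η : ℝ} (hm : 0 < m)
    (hc : 0 ≤ c) (hmlift : ∀ z, m * ‖z‖ ^ d ≤ ‖f.lift z‖) {O : Set (CP k)}
    (hη : ∀ s t : f.unitLift, f.lift s = f.lift t → f.fInf^[2] (f.toCP s) ∉ O →
      ∀ a b : ℂ, ‖a - f.res s‖ < η → ‖b - f.res t‖ < η → a ^ d = b ^ d → a = b)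
    (hsmall : ‖ε‖ ^ (d - 1) * (c ^ d / m) < η) {x : CP (k + 1)} (hxO : π x ∉ O) :
    Set.InjOn π {y | y ∈ f.U c ε ∧ y ∈ f.fEps ε '' f.U c ε ∧ f.fEps ε y = x} := by
  rintro y ⟨hy, ⟨p, hp, hpy⟩, hyx⟩ y' ⟨hy', ⟨p', hp', hpy'⟩, hyx'⟩ hyy
  obtain ⟨a, ha, ha1, hay⟩ := CP.exists_norm_eq_one (π y)
  obtain ⟨u, -, rfl⟩ := exists_pt_of_base_eq hε hπ hy ha hay.symm
  obtain ⟨u', -, rfl⟩ := exists_pt_of_base_eq hε hπ hy' ha (hyy.symm.trans hay.symm)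
  obtain ⟨w, t, hw, ht, hpw, hu⟩ := exists_unitLift_of_fEps_eq hε hπ ha ha1 hp hpy
  obtain ⟨w', t', hw', ht', -, hu'⟩ := exists_unitLift_of_fEps_eq hε hπ ha ha1 hp' hpy'
  have h1 := norm_sub_res_le (ε := ε) hm hc hmlift w.2 ht
  have h2 := norm_sub_res_le (ε := ε) hm hc hmlift w'.2 ht'
  rw [← hu] at h1
  rw [← hu'] at h2
  rw [hη w w' (hw.trans hw'.symm) ?_ u u' (h1.trans_lt hsmall) (h2.trans_lt hsmall)
    (pow_eq_pow_of_fEps_pt_eq hε ha (hyx.trans hyx'.symm))]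
  rw [Function.iterate_succ_apply', Function.iterate_one, ← hpw, ← base_fEps hε hπ hp, hpy,
    ← base_fEps hε hπ hy, hyx]
  exact hxO

end Fibers

theorem exists_forall_limsup_countMult_lt (hk : 2 ≤ k) (hXY : Disjoint f.X f.Y)
    (hZ : ∃ n : ℕ, (⋂ i ∈ Set.Iic n, f.fInf^[i] ⁻¹' f.Z) = ∅) {c : ℝ} (hc : 0 ≤ c) :
    ∃ δ > 0, ∀ ε : ℂ, ε ≠ 0 → ‖ε‖ ^ (d - 1) < δ → f.fEps ε '' f.U c ε ⊆ f.U c ε →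
      ∀ x, Filter.limsup (fun n : ℕ => ((countMult (f.fEps ε)^[n]
        ((f.fEps ε)^[n] ⁻¹' {x} ∩ f.openU c ε) : ℕ∞) : ℝ≥0∞) ^ (1 / (n : ℝ)))
        Filter.atTop < (d : ℝ≥0∞) ^ (k - 1) := by
  obtain ⟨n, O, O', hO, hO', hXO, hYO', hdis, horb⟩ := f.exists_separating_nhds hXY hZ
  obtain ⟨η, hη, hX⟩ := f.exists_encard_near_le hO hXO
  obtain ⟨η', hη', hY⟩ := f.exists_eq_of_pow_eq_near hO' hYO'
  obtain ⟨m, M, hm, -, hmM⟩ := f.exists_bounds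
  obtain ⟨π, hπ⟩ := exists_base (k := k) (by omega)
  -- The `+ 1` avoids a zero denominator when `c = 0`.
  refine ⟨min (η / 2) η' / (c ^ d / m + 1), by positivity, fun ε hε hδ hinv x => ?_⟩
  have hsmall : ‖ε‖ ^ (d - 1) * (c ^ d / m) < min (η / 2) η' := by
    rw [lt_div_iff₀ (by positivity)] at hδ
    refine lt_of_le_of_lt ?_ hδ
    gcongr
    linarith
  have hdpow : d ^ (k - 1) = d ^ (k - 2) * d := by
    rw [← pow_succ]
    congr 1
    omega
  have hnotX := fun x hx hxO => encard_image_base_le (c := c) hε hπ hm hc (fun z => (hmM z).1) hX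
    (hsmall.trans_le (min_le_left _ _)) (x := x) hx hxO
  have hnotY := fun x hxO => injOn_base (c := c) hε hπ hm hc (fun z => (hmM z).1) hY
    (hsmall.trans_le (min_le_right _ _)) (x := x) hxO
  have hbez : ∀ x, (π '' {y | y ∈ f.U c ε ∧ f.fEps ε y = x}).encard ≤ (d ^ (k - 1) : ℕ) :=
    fun x => (Set.encard_le_encard (image_base_subset hε hπ x)).trans
      (f.encard_fInf_fiber_le (by omega) _)
  have hsub : ∀ x, {y | y ∈ f.U c ε ∧ y ∈ f.fEps ε '' f.U c ε ∧ f.fEps ε y = x} ⊆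
      {y | y ∈ f.U c ε ∧ f.fEps ε y = x} := fun x y hy => ⟨hy.1, hy.2.2⟩
  have hinjle : ∀ (x : CP (k + 1)) (N : ℕ), π x ∉ O' →
      (π '' {y | y ∈ f.U c ε ∧ f.fEps ε y = x}).encard ≤ N →
      {y | y ∈ f.U c ε ∧ y ∈ f.fEps ε '' f.U c ε ∧ f.fEps ε y = x}.encard ≤ N := by
    intro x N hx hN
    rw [← (hnotY x hx).encard_image]
    exact (Set.encard_le_encard (Set.image_mono (hsub x))).trans hN
  refine limsup_countMult_lt (C := d ^ (k - 1) * d) (n₀ := n) (Z := O ∪ O') f.two_le_degree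
    (by omega) (f.isOpen_openU c ε) (f.openU_subset_U c ε) (fun p hp => base_fEps hε hπ hp)
    (fun p hp => hinv ⟨p, hp, rfl⟩) ?_ ?_ ?_ horb x
  · exact fun x _ => Set.encard_le_mul_of_fiber_le π _ (hbez x)
      fun q _ => encard_vertical_fiber_le hε hπ x q
  · intro x hx
    -- Disjointness of `O` and `O'` enters here: in `O` the saving is vertical, with `d ^ (k - 1)`
    -- base points and one point over each; off `O` it is horizontal, with `d ^ (k - 2)` base points
    -- and at most `d` points over each.
    by_cases hxO : π x ∈ O
    · exact hinjle x _ (Set.disjoint_left.1 hdis hxO) (hbez x)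
    · rw [hdpow]
      exact (Set.encard_le_encard (hsub x)).trans (Set.encard_le_mul_of_fiber_le π _
        (hnotX x hx hxO) fun q _ => encard_vertical_fiber_le hε hπ x q)
  · intro x hx hxZ
    rw [show k - 1 - 1 = k - 2 by omega]
    exact hinjle x _ (fun h => hxZ (Or.inr h)) (hnotX x hx fun h => hxZ (Or.inl h))

end PencilPair

end

/-! ### Choice of the constants and conclusion. -/

theorem mainTheorem5 (k d : ℕ) (hk : 2 ≤ k) (f : PencilPair k d)
    (hXY : Disjoint f.X f.Y)
    (hZ : ∃ n : ℕ, (⋂ i ∈ Set.Iic n, f.fInf^[i] ⁻¹' f.Z) = ∅) :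
    ∃ c₀ : ℝ, 0 < c₀ ∧ ∀ c : ℝ, c₀ ≤ c → ∃ ε₀ : ℝ, 0 < ε₀ ∧
      ∀ ε : ℂ, ε ≠ 0 → ‖ε‖ < ε₀ →
        IsTrappingRegion (f.fEps ε) (f.A c ε) (f.U c ε) ∧
        SatisfiesHD 1 (f.U c ε) ∧
        IsOfSmallTopologicalDegree (f.fEps ε) d (k - 1) (f.A c ε) := by
  obtain ⟨m, M, hm, hM, hmM⟩ := f.exists_bounds
  -- With `‖ε‖ ^ (d - 1) c ^ d ≤ 1 / 2` the image lies in the closed tube of constant `(M + 1 / 2) /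
  -- m`, strictly less than `(M + 1) / m ≤ c`. The open tube of constant `c` fits in between and
  -- serves as the open trapping region.
  refine ⟨(M + 1) / m, by positivity, fun c hc => ?_⟩
  have hc0 : 0 < c := lt_of_lt_of_le (by positivity) hc
  obtain ⟨δ, hδ, hdeg⟩ := f.exists_forall_limsup_countMult_lt hk hXY hZ hc0.le
  refine ⟨min 1 (min δ (1 / (2 * c ^ d))), by positivity, fun ε hε hεlt => ?_⟩
  rw [lt_min_iff, lt_min_iff] at hεlt
  obtain ⟨hε1, hεδ, hεc⟩ := hεlt
  have hpow : ‖ε‖ ^ (d - 1) ≤ ‖ε‖ := by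
    have := f.two_le_degree
    exact pow_le_of_le_one (norm_nonneg _) hε1.le (by omega)
  have hsmall : ‖ε‖ ^ (d - 1) * c ^ d ≤ 1 / 2 := by
    have h1 : ‖ε‖ ^ (d - 1) * c ^ d ≤ 1 / (2 * c ^ d) * c ^ d := by
      gcongr
      exact hpow.trans hεc.le
    rwa [show 1 / (2 * c ^ d) * c ^ d = 1 / 2 by field_simp] at h1
  have hlt : (M + 1 / 2) / m < c :=
    lt_of_lt_of_le (div_lt_div_of_pos_right (by linarith) hm) hc
  have himg : f.fEps ε '' f.U c ε ⊆ f.U ((M + 1 / 2) / m) ε :=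
    f.image_U_subset hε (by positivity) hmM (by
      rw [div_mul_cancel₀ _ hm.ne']
      linarith)
  have hVW := f.U_subset_openU hε hlt
  have hWU := f.openU_subset_U c ε
  have hV := f.isClosed_U ((M + 1 / 2) / m) ε
  have hW := f.isOpen_openU c ε
  refine ⟨isTrappingRegion_of_subset hV hW himg hVW hWU, f.satisfiesHD_U (by omega) hc0.le ε,
    isAttractingSet_of_subset (f.continuous_fEps ε) (f.isClosed_U c ε) hV hW himg hVW hWU,
    f.openU c ε, hW, isTrappingRegion_open_of_subset hV hW himg hVW hWU, ?_⟩
  exact hdeg ε hε (hpow.trans_lt hεδ) (himg.trans (hVW.trans hWU))
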